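/- Let $M_1$ be the space of degree one holomorphic maps $\phi:S^2\to S^2$, $z\mapsto W(z)=\frac{a_1z+a_2}{a_3z+a_4}$ with $a_1a_4-a_2a_3\neq 0$, where $z$ and $W$ are stereographic coordinates. Since $(a_1,\dots,a_4)$ matters only up to a nonzero complex factor, $M_1=PL(2,\mathbb C)$, a smooth manifold of real dimension 6. Let $\gamma$ be the $L^2$ metric on $M_1$: for $X,Y\in T_\phi M_1$, regarded as sections of $\phi^*TS^2$, $$\gamma(X,Y)=\int_{S^2}h(X,Y)=\int_{\mathbb C}\frac{\mathrm{Re}\big(\partial_XW\,\overline{\partial_YW}\big)}{(1+|W|^2)^2}\,\frac{dx\,dy}{(1+|z|^2)^2}\qquad(z=x+iy)$$ up to a constant factor, where $h$ is the round metric on the target sphere. Every point of $M_1$ is $[U(\sqrt{1+\lambda^2}\,\mathbb I_2+\boldsymbol\lambda\cdot\boldsymbol\tau)]$ with $U$ unitary (unique up to phase), a unique $\boldsymbol\lambda\in\mathbb R^3$, $\lambda=|\boldsymbol\lambda|$, and $\boldsymbol\tau=(\tau_1,\tau_2,\tau_3)$ the Pauli matrices; this defines the function $\boldsymbol\lambda:M_1\to\mathbb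 R^3$. The position of the lump $\phi$ is a point of the domain $S^2\subset\mathbb R^3$ at which the energy density $\frac12|d\phi|^2$ is maximal, where the point of $S^2$ with homogeneous coordinates $v\in\mathbb C^2\setminus\{0\}$, $v=(z,1)$, is $v^\dagger\boldsymbol\tau v/|v|^2$. (If $\boldsymbol\lambda\neq\boldsymbol 0$, the position is the single point $-\boldsymbol\lambda/\lambda$; if $\boldsymbol\lambda=\boldsymbol 0$, the energy density is constant and every point of $S^2$ is a position.) There is an open dense set $\mathcal G\subset TM_1$ whose complement has measure zero in $TM_1$, and whose complement meets $T_\phi M_1$ in a set of measure zero for every $\phi\in M_1$ with $\boldsymbol\lambda(\phi)\neq\boldsymbol 0$, such that for every geodesic $\phi_t$, $t\in(-\varepsilon,\varepsilon)$, $\varepsilon>0$, of $(M_1,\gamma)$ with initial velocity $\dot\phi_0\in\mathcal G$: 1. there is no plane through the origin of $\mathbb R^3$ that contains $\boldsymbol\lambda(\phi_t)$ for all $t\in(-\varepsilon,\varepsilon)$; 2. there is no great circle of $S^2$ that contains a position of the lump $\phi_t$ for every $t\in(-\varepsilon,\varepsilon)$. That is, in the geodesic approximation, in which a slowly moving lump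 follows a geodesic of $(M_1,\gamma)$, the lump does not travel along a great circle. -/

import Mathlib

open Matrix MeasureTheory Set
open scoped MatrixGroups ContDiff

noncomputable section

namespace Lump

/-! ## Degree one holomorphic maps of the sphere

The moduli space `M₁` of degree one holomorphic maps `ℂP¹ → ℂP¹`,
`z ↦ (a₁ z + a₂) / (a₃ z + a₄)` with `a₁ a₄ - a₂ a₃ ≠ 0`, is `PL(2, ℂ)`: the map is
`[v] ↦ [a v]` in homogeneous coordinates `v = (z, 1)`, and `a` matters only up to a
nonzero complex factor. -/

/-- The vector space `ℂ⁴` of coefficients `(a₁, a₂; a₃, a₄)`, with its Lebesgue measure. -/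
abbrev Coeff : Type := Fin 2 → Fin 2 → ℂ

/-- The moduli space of one-lump solutions. -/
abbrev M₁ : Type := PGL(2, ℂ)

/-- The invertible matrix with given coefficients. -/
def toGL (a : Coeff) (h : (of a).det ≠ 0) : GL (Fin 2) ℂ :=
  Matrix.GeneralLinearGroup.mkOfDetNeZero (of a) h

/-- The degree one map with given coefficients. -/
def toM₁ (a : Coeff) (h : (of a).det ≠ 0) : M₁ :=
  Matrix.ProjGenLinGroup.mk (toGL a h)

/-! ## Tangent vectors

A tangent vector of `M₁` at the class of `a` is the velocity of `s ↦ [a + s X]`, for some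
`X : Coeff`. Replacing the curve `a(s)` by `c(s) a(s)`, with `c(s)` a nonzero scalar, replaces
`(a, X)` by `(c a, c X + d a)`, and these are the only identifications. -/

/-- Coordinates of tangent vectors: pairs `(a, X)` with `a` invertible. -/
abbrev TCoord : Type := {q : Coeff × Coeff // (of q.1).det ≠ 0}

/-- Two coordinate pairs represent the same tangent vector. -/
instance tangentSetoid : Setoid TCoord where
  r p q := ∃ c d : ℂ, c ≠ 0 ∧ q.1.1 = c • p.1.1 ∧ q.1.2 = c • p.1.2 + d • p.1.1
  iseqv := by
    refine ⟨fun p => ⟨1, 0, one_ne_zero, by simp, by simp⟩, ?_, ?_⟩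
    · rintro p q ⟨c, d, hc, h1, h2⟩
      refine ⟨c⁻¹, -(c⁻¹ * c⁻¹ * d), inv_ne_zero hc, ?_, ?_⟩
      · rw [h1, smul_smul, inv_mul_cancel₀ hc, one_smul]
      · rw [h2, h1, smul_add, smul_smul, smul_smul, smul_smul, inv_mul_cancel₀ hc, one_smul,
          add_assoc, ← add_smul]
        have : c⁻¹ * d + -(c⁻¹ * c⁻¹ * d) * c = 0 := by field_simp; ring
        rw [this, zero_smul, add_zero]
    · rintro p q r ⟨c, d, hc, h1, h2⟩ ⟨c', d', hc', h1', h2'⟩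
      refine ⟨c' * c, c' * d + d' * c, mul_ne_zero hc' hc, ?_, ?_⟩
      · rw [h1', h1, smul_smul]
      · rw [h2', h2, h1, smul_add, smul_smul, smul_smul, smul_smul, add_smul, add_assoc]

/-- The tangent bundle `T M₁`, with the quotient topology. -/
def TM₁ : Type := Quotient tangentSetoid

instance : TopologicalSpace TM₁ := inferInstanceAs (TopologicalSpace (Quotient tangentSetoid))

/-- The tangent vector at `[a]` represented by `X`. -/
def tangent (a X : Coeff) (h : (of a).det ≠ 0) : TM₁ :=
  Quotient.mk tangentSetoid ⟨(a, X), h⟩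

/-- A set of tangent vectors has measure zero in the manifold `T M₁`. The projection
`(a, X) ↦ tangent a X` is a surjective submersion from an open set of `ℂ⁸`, so a subset of
`T M₁` has measure zero in charts if and only if its preimage has Lebesgue measure zero. -/
def NullInTM₁ (S : Set TM₁) : Prop :=
  volume {q : Coeff × Coeff | ∃ h : (of q.1).det ≠ 0, tangent q.1 q.2 h ∈ S} = 0

/-- A set of tangent vectors has measure zero in the fibre `T_x M₁` at `x = [a]`. The fibre is
the vector space `ℂ⁴ / ℂ a`. -/
def NullInFibre (a : Coeff) (h : (of a).det ≠ 0) (S : Set TM₁) : Prop :=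
  volume {X : Coeff | tangent a X h ∈ S} = 0

/-! ## The L² metric -/

/-- `|v|²` on `ℂ²`. -/
def nsq (v : Fin 2 → ℂ) : ℝ := ‖v 0‖ ^ 2 + ‖v 1‖ ^ 2

/-- `w ∧ u` on `ℂ²`. -/
def wedge (w u : Fin 2 → ℂ) : ℂ := w 1 * u 0 - w 0 * u 1

/-- The fibrewise inner product `h(X, Y)` at the point `[v]` of the two sections of `φ^*TN`
represented by `X` and `Y`, where `φ = [a]`, in terms of the homogeneous coordinates of the
target sphere. -/
def sectionInner (a X Y : Coeff) (v : Fin 2 → ℂ) : ℝ :=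
  (wedge (of a *ᵥ v) (of X *ᵥ v) * star (wedge (of a *ᵥ v) (of Y *ᵥ v))).re /
    nsq (of a *ᵥ v) ^ 2

/-- The value at `z` of the rational function `W(z) = (a₁ z + a₂) / (a₃ z + a₄)`. -/
def ratFun (a : Coeff) (z : ℂ) : ℂ := (a 0 0 * z + a 0 1) / (a 1 0 * z + a 1 1)

/-- In the coordinate `W` of the target sphere, `sectionInner` is
`Re (∂_X W * conj (∂_Y W)) / (1 + |W|²)²`. -/
theorem sectionInner_eq (a X Y : Coeff) (z : ℂ) (hz : a 1 0 * z + a 1 1 ≠ 0) :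
    sectionInner a X Y ![z, 1] =
      (deriv (fun s : ℂ => ratFun (a + s • X) z) 0 *
        star (deriv (fun s : ℂ => ratFun (a + s • Y) z) 0)).re / (1 + ‖ratFun a z‖ ^ 2) ^ 2 := by
  have key : ∀ X : Coeff, deriv (fun s : ℂ => ratFun (a + s • X) z) 0 =
      wedge (of a *ᵥ ![z, 1]) (of X *ᵥ ![z, 1]) / (a 1 0 * z + a 1 1) ^ 2 := by
    intro X
    have h1 : HasDerivAt (fun s : ℂ => (a 0 0 + s * X 0 0) * z + (a 0 1 + s * X 0 1))
        (X 0 0 * z + X 0 1) 0 := by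
      have := ((((hasDerivAt_id (0 : ℂ)).mul_const (X 0 0)).const_add (a 0 0)).mul_const z).add
        (((hasDerivAt_id (0 : ℂ)).mul_const (X 0 1)).const_add (a 0 1))
      simpa [Function.comp_def, Pi.add_def] using! this
    have h2 : HasDerivAt (fun s : ℂ => (a 1 0 + s * X 1 0) * z + (a 1 1 + s * X 1 1))
        (X 1 0 * z + X 1 1) 0 := by
      have := ((((hasDerivAt_id (0 : ℂ)).mul_const (X 1 0)).const_add (a 1 0)).mul_const z).add
        (((hasDerivAt_id (0 : ℂ)).mul_const (X 1 1)).const_add (a 1 1))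
      simpa [Function.comp_def, Pi.add_def] using! this
    have h3 := h1.div h2 (by simpa using hz)
    have h4 : (fun s : ℂ => ratFun (a + s • X) z) =
        (fun s : ℂ => (a 0 0 + s * X 0 0) * z + (a 0 1 + s * X 0 1)) /
          (fun s : ℂ => (a 1 0 + s * X 1 0) * z + (a 1 1 + s * X 1 1)) := by
      funext s; simp [ratFun]
    rw [h4, h3.deriv]
    simp [wedge, mulVec, dotProduct, Fin.sum_univ_two]
    ring
  rw [key X, key Y]
  have hn : nsq (of a *ᵥ ![z, 1]) = ‖a 1 0 * z + a 1 1‖ ^ 2 * (1 + ‖ratFun a z‖ ^ 2) := by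
    have h0 : ‖a 1 0 * z + a 1 1‖ ≠ 0 := norm_ne_zero_iff.2 hz
    have h8 : nsq (of a *ᵥ ![z, 1]) = ‖a 0 0 * z + a 0 1‖ ^ 2 + ‖a 1 0 * z + a 1 1‖ ^ 2 := by
      simp [nsq, mulVec, dotProduct, Fin.sum_univ_two]
    rw [h8, ratFun, norm_div]
    generalize ‖a 1 0 * z + a 1 1‖ = r at h0
    field_simp
    ring
  have hre : ∀ p q : ℂ, (p / (a 1 0 * z + a 1 1) ^ 2 * star (q / (a 1 0 * z + a 1 1) ^ 2)).re =
      (p * star q).re / ‖a 1 0 * z + a 1 1‖ ^ 4 := by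
    intro p q
    have h5 : p / (a 1 0 * z + a 1 1) ^ 2 * star (q / (a 1 0 * z + a 1 1) ^ 2) =
        (p * star q) / ((‖a 1 0 * z + a 1 1‖ ^ 4 : ℝ) : ℂ) := by
      have h6 : ((‖a 1 0 * z + a 1 1‖ ^ 4 : ℝ) : ℂ) =
          (a 1 0 * z + a 1 1) ^ 2 * star ((a 1 0 * z + a 1 1) ^ 2) := by
        have h7 := Complex.mul_conj' (a 1 0 * z + a 1 1)
        rw [star_pow, ← mul_pow]
        change _ = ((a 1 0 * z + a 1 1) * (starRingEnd ℂ) (a 1 0 * z + a 1 1)) ^ 2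
        rw [h7]; push_cast; ring
      rw [h6, star_div₀, div_mul_div_comm]
    rw [h5, Complex.div_ofReal_re]
  rw [hre, sectionInner, hn, div_div]
  congr 1
  ring

/-- The `L²` metric `γ`: the integral of `h(X, Y)` over the domain sphere, whose area form in the
stereographic coordinate `z` is `dx dy / (1 + |z|²)²` up to a constant factor. -/
def gam (a X Y : Coeff) : ℝ :=
  ∫ z : ℂ, sectionInner a X Y ![z, 1] / (1 + ‖z‖ ^ 2) ^ 2

/-- `γ` is well defined on tangent vectors of `M₁`. -/
theorem gam_descends (a X Y : Coeff) (c d e : ℂ) (hc : c ≠ 0) :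
    gam (c • a) (c • X + d • a) (c • Y + e • a) = gam a X Y := by
  have hw : ∀ (X : Coeff) (d : ℂ) (v : Fin 2 → ℂ),
      wedge (of (c • a) *ᵥ v) (of (c • X + d • a) *ᵥ v) =
        c ^ 2 * wedge (of a *ᵥ v) (of X *ᵥ v) := by
    intro X d v
    simp [wedge, mulVec, dotProduct, Fin.sum_univ_two]
    ring
  have hn : ∀ v : Fin 2 → ℂ, nsq (of (c • a) *ᵥ v) = ‖c‖ ^ 2 * nsq (of a *ᵥ v) := by
    intro v
    have : of (c • a) *ᵥ v = c • (of a *ᵥ v) := by rw [← smul_mulVec]; rfl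
    rw [this]; simp [nsq]; ring
  unfold gam
  congr 1
  funext z
  congr 1
  unfold sectionInner
  rw [hw, hw, hn, star_mul']
  have h1 : ∀ p q : ℂ, c ^ 2 * p * (star (c ^ 2) * star q) = ((‖c‖ ^ 4 : ℝ) : ℂ) * (p * star q) := by
    intro p q
    have h7 := Complex.mul_conj' c
    have : c ^ 2 * star (c ^ 2) = ((‖c‖ ^ 4 : ℝ) : ℂ) := by
      rw [star_pow, ← mul_pow]
      change (c * (starRingEnd ℂ) c) ^ 2 = _
      rw [h7]; push_cast; ring
    rw [← this]; ring
  rw [h1, Complex.re_ofReal_mul, mul_pow]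
  have : ‖c‖ ≠ 0 := norm_ne_zero_iff.2 hc
  rw [← pow_mul, mul_div_mul_left _ _ (pow_ne_zero _ this)]

/-! ## Geodesics -/

/-- `x : (-ε, ε) → M₁` is a geodesic of `(M₁, γ)` with initial velocity `ξ ∈ T M₁`.

The curve is given by a smooth coefficient curve `a(t)`, and the geodesic equation
`γ(∇_{ẋ} ẋ, Y) = 0` is written in coordinates with the free index lowered, that is, as
`d/dt γ_a(ȧ, Y) = ½ ∂_Y γ_a(ȧ, ȧ)` for every constant vector `Y`
(the derivative `∂_Y` acts on the base point only). These are the Euler-Lagrange equations of the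
energy `½ ∫ γ(ẋ, ẋ) dt`, hence do not depend on the choice of the coefficient curve. -/
def IsGeodesic (x : ℝ → M₁) (ε : ℝ) (ξ : TM₁) : Prop :=
  ∃ a : ℝ → Coeff,
    ContDiffOn ℝ ∞ a (Ioo (-ε) ε) ∧
    (∀ t ∈ Ioo (-ε) ε, ∃ h : (of (a t)).det ≠ 0, toM₁ (a t) h = x t) ∧
    (∃ h : (of (a 0)).det ≠ 0, tangent (a 0) (deriv a 0) h = ξ) ∧
    ∀ t ∈ Ioo (-ε) ε, ∀ Y : Coeff,
      HasDerivAt (fun s => gam (a s) (deriv a s) Y)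
        (1 / 2 * deriv (fun r : ℝ => gam (a t + r • Y) (deriv a t) (deriv a t)) 0) t

/-! ## Polar decomposition -/

/-- The Pauli matrices. -/
def pauli : Fin 3 → Matrix (Fin 2) (Fin 2) ℂ :=
  ![!![0, 1; 1, 0], !![0, -Complex.I; Complex.I, 0], !![1, 0; 0, -1]]

/-- Euclidean three-space. -/
abbrev E₃ : Type := EuclideanSpace ℝ (Fin 3)

/-- `√(1 + λ²) 𝕀 + 𝛌 ⬝ 𝛕`, where `λ = |𝛌|`. -/
def boost (l : E₃) : Matrix (Fin 2) (Fin 2) ℂ :=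
  ((√(1 + ‖l‖ ^ 2) : ℝ) : ℂ) • 1 + ∑ i, ((l i : ℝ) : ℂ) • pauli i

/-- `x = [U (√(1 + λ²) 𝕀 + 𝛌 ⬝ 𝛕)]` with `U` unitary. -/
def IsPolar (x : M₁) (l : E₃) : Prop :=
  ∃ U ∈ unitaryGroup (Fin 2) ℂ, ∃ g : GL (Fin 2) ℂ,
    (g : Matrix (Fin 2) (Fin 2) ℂ) = U * boost l ∧ Matrix.ProjGenLinGroup.mk g = x

theorem norm_sq_E₃ (l : E₃) : ‖l‖ ^ 2 = l 0 ^ 2 + l 1 ^ 2 + l 2 ^ 2 := by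
  simp [EuclideanSpace.norm_sq_eq, Fin.sum_univ_three]

theorem boost_eq (l : E₃) : boost l =
    !![((√(1 + ‖l‖ ^ 2) : ℝ) : ℂ) + l 2, l 0 - Complex.I * l 1;
      l 0 + Complex.I * l 1, ((√(1 + ‖l‖ ^ 2) : ℝ) : ℂ) - l 2] := by
  ext i j
  fin_cases i <;> fin_cases j <;> simp [boost, pauli, Fin.sum_univ_three] <;> ring

theorem boost_conjTranspose (l : E₃) : (boost l)ᴴ = boost l := by
  rw [boost_eq]
  ext i j
  fin_cases i <;> fin_cases j <;> simp [Matrix.conjTranspose_apply]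
  ring

theorem sqrt_sq_cast (l : E₃) : ((√(1 + ‖l‖ ^ 2) : ℝ) : ℂ) ^ 2 =
    1 + ((l 0 : ℝ) : ℂ) ^ 2 + ((l 1 : ℝ) : ℂ) ^ 2 + ((l 2 : ℝ) : ℂ) ^ 2 := by
  have h : √(1 + ‖l‖ ^ 2) ^ 2 = 1 + l 0 ^ 2 + l 1 ^ 2 + l 2 ^ 2 := by
    rw [Real.sq_sqrt (by positivity), norm_sq_E₃]; ring
  exact_mod_cast h

theorem boost_mul_neg (l : E₃) : boost l * boost (-l) = 1 := by
  have h := sqrt_sq_cast l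
  have hI := Complex.I_sq
  rw [boost_eq, boost_eq, norm_neg]
  ext i j
  fin_cases i <;> fin_cases j <;> simp [Matrix.mul_apply, Fin.sum_univ_two]
  · linear_combination h + ((l 1 : ℝ) : ℂ) ^ 2 * hI
  · ring
  · ring
  · linear_combination h + ((l 1 : ℝ) : ℂ) ^ 2 * hI

theorem det_boost (l : E₃) : (boost l).det = 1 := by
  have h := sqrt_sq_cast l
  have hI := Complex.I_sq
  rw [boost_eq, det_fin_two_of]
  linear_combination h + ((l 1 : ℝ) : ℂ) ^ 2 * hI

theorem boost_sq (l : E₃) : boost l * boost l =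
    !![1 + 2 * ((‖l‖ ^ 2 : ℝ) : ℂ) + 2 * (√(1 + ‖l‖ ^ 2) : ℝ) * l 2,
        2 * (√(1 + ‖l‖ ^ 2) : ℝ) * (l 0 - Complex.I * l 1);
      2 * (√(1 + ‖l‖ ^ 2) : ℝ) * (l 0 + Complex.I * l 1),
        1 + 2 * ((‖l‖ ^ 2 : ℝ) : ℂ) - 2 * (√(1 + ‖l‖ ^ 2) : ℝ) * l 2] := by
  have h := sqrt_sq_cast l
  have hn : ((‖l‖ ^ 2 : ℝ) : ℂ) = ((l 0 : ℝ) : ℂ) ^ 2 + ((l 1 : ℝ) : ℂ) ^ 2 +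
      ((l 2 : ℝ) : ℂ) ^ 2 := by exact_mod_cast norm_sq_E₃ l
  have hI := Complex.I_sq
  rw [hn, boost_eq]
  ext i j
  fin_cases i <;> fin_cases j <;> simp [Matrix.mul_apply, Fin.sum_univ_two]
  · linear_combination h - ((l 1 : ℝ) : ℂ) ^ 2 * hI
  · ring
  · ring
  · linear_combination h - ((l 1 : ℝ) : ℂ) ^ 2 * hI

theorem exists_isPolar (x : M₁) : ∃ l, IsPolar x l := by
  obtain ⟨g, rfl⟩ := Matrix.ProjGenLinGroup.mk_surjective x
  set L : Matrix (Fin 2) (Fin 2) ℂ := (g : Matrix (Fin 2) (Fin 2) ℂ) with hL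
  have hdet : L.det ≠ 0 := (Matrix.isUnit_iff_isUnit_det _).1 g.isUnit |>.ne_zero
  set D : ℝ := ‖L.det‖ with hD
  have hDpos : 0 < D := norm_pos_iff.2 hdet
  set α : ℝ := Complex.normSq (L 0 0) + Complex.normSq (L 1 0) with hα
  set δ : ℝ := Complex.normSq (L 0 1) + Complex.normSq (L 1 1) with hδ
  set β : ℂ := star (L 0 0) * L 0 1 + star (L 1 0) * L 1 1 with hβ
  have hrel : α * δ - (β.re ^ 2 + β.im ^ 2) = D ^ 2 := by
    rw [hD, ← Complex.normSq_eq_norm_sq, det_fin_two, hα, hδ, hβ]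
    simp [Complex.normSq_apply]
    ring
  have hα0 : 0 ≤ α := add_nonneg (Complex.normSq_nonneg _) (Complex.normSq_nonneg _)
  have hδ0 : 0 ≤ δ := add_nonneg (Complex.normSq_nonneg _) (Complex.normSq_nonneg _)
  set p : ℝ := (α + δ) / (2 * D) with hp
  have hp0 : 0 ≤ p := by positivity
  set k : ℝ := √(2 * (p + 1)) with hk
  have hkpos : 0 < k := Real.sqrt_pos.2 (by positivity)
  have hk2 : k ^ 2 = 2 * (p + 1) := Real.sq_sqrt (by positivity)
  let l : E₃ := !₂[β.re / D / k, -β.im / D / k, (α - δ) / (2 * D) / k]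
  have hl0 : l 0 = β.re / D / k := rfl
  have hl1 : l 1 = -β.im / D / k := rfl
  have hl2 : l 2 = (α - δ) / (2 * D) / k := rfl
  have hps : (β.re / D) ^ 2 + (-β.im / D) ^ 2 + ((α - δ) / (2 * D)) ^ 2 = p ^ 2 - 1 := by
    rw [hp]; field_simp; nlinarith [hrel]
  have hnl : ‖l‖ ^ 2 = (p - 1) / 2 := by
    have h1 : ‖l‖ ^ 2 = ((β.re / D) ^ 2 + (-β.im / D) ^ 2 + ((α - δ) / (2 * D)) ^ 2) / k ^ 2 := by
      rw [norm_sq_E₃, hl0, hl1, hl2]; ring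
    rw [h1, hps, hk2]
    have : p + 1 ≠ 0 := by positivity
    field_simp
    ring
  have hs : 2 * √(1 + ‖l‖ ^ 2) = k := by
    have h1 : (2 * √(1 + ‖l‖ ^ 2)) ^ 2 = 2 * (p + 1) := by
      rw [mul_pow, Real.sq_sqrt (by positivity), hnl]; ring
    rw [hk, ← h1, Real.sqrt_sq (by positivity)]
  have hsc : 2 * ((√(1 + ‖l‖ ^ 2) : ℝ) : ℂ) = (k : ℂ) := by exact_mod_cast hs
  have hB : ((D : ℝ) : ℂ) • (boost l * boost l) = Lᴴ * L := by
    have e0 : D * (k * l 0) = β.re := by rw [hl0]; field_simp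
    have e1 : D * (k * l 1) = -β.im := by rw [hl1]; field_simp
    have e2 : D * (1 + 2 * ‖l‖ ^ 2 + k * l 2) = α := by
      rw [hnl, hl2, hp]; field_simp; ring
    have e3 : D * (1 + 2 * ‖l‖ ^ 2 - k * l 2) = δ := by
      rw [hnl, hl2, hp]; field_simp; ring
    rw [boost_sq, hsc]
    ext i j
    fin_cases i <;> fin_cases j <;> apply Complex.ext
    all_goals simp [Matrix.mul_apply, Fin.sum_univ_two, Matrix.conjTranspose_apply,
      -Complex.ofReal_pow]
    all_goals simp [hα, hδ, hβ, Complex.normSq_apply, -Complex.ofReal_pow] at e0 e1 e2 e3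
    all_goals linarith
  have hr : ((√D : ℝ) : ℂ) ≠ 0 := by
    exact_mod_cast (Real.sqrt_pos.2 hDpos).ne'
  have hrr : ((√D : ℝ) : ℂ) * ((√D : ℝ) : ℂ) = (D : ℂ) := by
    exact_mod_cast Real.mul_self_sqrt hDpos.le
  have hneg : boost (-l) * boost l = 1 := by simpa using boost_mul_neg (-l)
  set r : ℂ := ((√D : ℝ) : ℂ) with hr_def
  have hrstar : star r = r := Complex.conj_ofReal _
  let U : Matrix (Fin 2) (Fin 2) ℂ := r⁻¹ • (L * boost (-l))
  have hUB : U * boost l = r⁻¹ • L := by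
    simp only [U, smul_mul_assoc, mul_assoc, hneg, mul_one]
  refine ⟨l, U, ?_, g * Matrix.GeneralLinearGroup.scalar (Fin 2) (Units.mk0 r⁻¹ (inv_ne_zero hr)),
    ?_, ?_⟩
  · rw [mem_unitaryGroup_iff', star_eq_conjTranspose]
    simp only [U, conjTranspose_smul, conjTranspose_mul, boost_conjTranspose, smul_mul_assoc,
      mul_smul_comm, smul_smul]
    rw [mul_assoc, ← mul_assoc Lᴴ, ← hB, star_inv₀, hrstar, smul_mul_assoc, mul_smul_comm, smul_smul]
    have h1 : boost (-l) * (boost l * boost l * boost (-l)) = 1 := by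
      rw [mul_assoc (boost l), boost_mul_neg, mul_one, hneg]
    rw [h1, ← hrr]
    have : r⁻¹ * r⁻¹ * (r * r) = 1 := by field_simp
    rw [this, one_smul]
  · rw [hUB]
    ext i j
    simp [hL, mul_comm]
  · rw [map_mul, Matrix.ProjGenLinGroup.mk_scalar, mul_one]

theorem isPolar_unique {x : M₁} {l l' : E₃} (h : IsPolar x l) (h' : IsPolar x l') : l = l' := by
  obtain ⟨U, hU, g, hg, rfl⟩ := h
  obtain ⟨U', hU', g', hg', hx⟩ := h'
  obtain ⟨u, hu⟩ := Matrix.ProjGenLinGroup.mk_eq_mk_iff.1 hx.symm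
  have hm : U' * boost l' = (u : ℂ) • (U * boost l) := by
    rw [← hg', ← hg, ← hu]
    ext i j
    simp [mul_comm]
  have hsq : ∀ (V : Matrix (Fin 2) (Fin 2) ℂ) (_ : V ∈ unitaryGroup (Fin 2) ℂ) (m : E₃),
      (V * boost m)ᴴ * (V * boost m) = boost m * boost m := by
    intro V hV m
    have hV' : Vᴴ * V = 1 := by
      rw [← star_eq_conjTranspose]; exact mem_unitaryGroup_iff'.1 hV
    rw [conjTranspose_mul, boost_conjTranspose, mul_assoc, ← mul_assoc Vᴴ, hV', one_mul]
  have h1 : boost l' * boost l' = (((‖(u : ℂ)‖ ^ 2 : ℝ) : ℂ)) • (boost l * boost l) := by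
    rw [← hsq U' hU' l', hm, conjTranspose_smul, smul_mul_assoc, mul_smul_comm, hsq U hU, smul_smul]
    congr 1
    have := Complex.conj_mul' (u : ℂ)
    simpa using! this
  have hu1 : ‖(u : ℂ)‖ ^ 2 = 1 := by
    have h2 := congrArg Matrix.det h1
    rw [det_smul, det_mul, det_mul, det_boost, det_boost] at h2
    have h3 : (1 : ℝ) = (‖(u : ℂ)‖ ^ 2) ^ 2 := by
      simp at h2
      exact_mod_cast h2
    nlinarith [sq_nonneg ‖(u : ℂ)‖]
  rw [hu1, Complex.ofReal_one, one_smul, boost_sq, boost_sq] at h1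
  have a00 := congrArg Complex.re (congrFun (congrFun h1 0) 0)
  have a01r := congrArg Complex.re (congrFun (congrFun h1 0) 1)
  have a01i := congrArg Complex.im (congrFun (congrFun h1 0) 1)
  have a11 := congrArg Complex.re (congrFun (congrFun h1 1) 1)
  simp [-Complex.ofReal_pow] at a00 a01r a01i a11
  have hn : ‖l'‖ ^ 2 = ‖l‖ ^ 2 := by linarith
  rw [hn] at a00 a01r a01i
  have hs : 0 < √(1 + ‖l‖ ^ 2) := Real.sqrt_pos.2 (by positivity)
  have hs2 : 2 * √(1 + ‖l‖ ^ 2) ≠ 0 := by positivity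
  ext i
  fin_cases i
  · exact (mul_left_cancel₀ hs2 a01r).symm
  · exact (mul_left_cancel₀ hs2 a01i).symm
  · exact (mul_left_cancel₀ hs2 (add_left_cancel a00)).symm

/-- The vector `𝛌 ∈ ℝ³` of the polar decomposition. -/
def lam (x : M₁) : E₃ := (exists_isPolar x).choose

theorem isPolar_iff (x : M₁) (l : E₃) : IsPolar x l ↔ l = lam x :=
  ⟨fun h => isPolar_unique h (exists_isPolar x).choose_spec,
    fun h => h ▸ (exists_isPolar x).choose_spec⟩

/-! ## The position of a lump -/

/-- The point of the unit sphere `S² ⊂ ℝ³` with homogeneous coordinates `v ≠ 0`, namely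
`v† 𝛕 v / |v|²`. -/
def spherePoint (v : Fin 2 → ℂ) : E₃ :=
  WithLp.toLp 2 fun i => (star v ⬝ᵥ (pauli i *ᵥ v)).re / nsq v

/-- The energy density `½ |dφ|²` at the point `[v]` of the map `[g]`, up to a constant factor.
At `v = (z, 1)` this is `|W'(z)|² (1 + |z|²)² / (1 + |W(z)|²)²`. -/
def energyDensity (g : GL (Fin 2) ℂ) (v : Fin 2 → ℂ) : ℝ :=
  ‖(g : Matrix (Fin 2) (Fin 2) ℂ).det‖ ^ 2 * nsq v ^ 2 /
    nsq ((g : Matrix (Fin 2) (Fin 2) ℂ) *ᵥ v) ^ 2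

/-- `p ∈ S²` is a point where the energy density of the lump `x` is maximal. (For `𝛌 ≠ 0` the only
such point is `-𝛌/λ`; for `𝛌 = 0` the energy density is constant, and all points qualify.) -/
def IsLumpPosition (x : M₁) (p : E₃) : Prop :=
  ∃ g : GL (Fin 2) ℂ, Matrix.ProjGenLinGroup.mk g = x ∧ ∃ v : Fin 2 → ℂ, v ≠ 0 ∧
    spherePoint v = p ∧ ∀ w : Fin 2 → ℂ, w ≠ 0 → energyDensity g w ≤ energyDensity g v

end Lump

/-!
A curve `a(t)` of matrices over `M₁` keeps `𝛌` in the plane orthogonal to `n` if and only if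
`tr (N H) = 0` along it, where `N = n · τ` and `H = aᴴ a`, because the vector part of `H` is a
positive multiple of `𝛌`. The proof turns this into an algebraic condition on the initial velocity.

Rotations of the target and of the domain sphere are isometries of the metric (`l2_mul_left`,
`l2_mul_right`), so along a geodesic the momenta `γ(ȧ, Z a)` and `γ(ȧ, a Z)` are constant for each
skew-Hermitian traceless `Z` (`conservesMomenta_of_geodesic`). On the directions `a M` with
`tr M = tr (H M) = 0` the metric is proportional to the Frobenius inner product
(`l2_eq_zero_of_trace`): when `H = diag(b, d)` these are the `M` with zero diagonal, and the two
radial integrals that occur are in the ratio `b : d` because the difference of the integrands has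
an explicit primitive. If `tr (N H)` vanishes identically then so does its derivative, which is
twice the Frobenius product of `ȧ` with `a N`; hence `γ(ȧ, a N) = 0`. On the other hand, up to a
scalar function, `a N` is `Z a - a W` with `Z = 2 a [N, H] aᴴ` and `W = tr H • [N, H]` skew-Hermitian
and traceless (`two_smul_commutator_mul`). So a combination of conserved momenta, with coefficients
that depend on `t` only through `a(t)`, vanishes identically. Its derivative at `t = 0` involves no
second derivative of `a`, and gives `γ(ȧ, planeDefect N a ȧ) = 0` for the initial data
(`ConservesMomenta.l2_planeDefect_eq_zero`).

The normal `n` is eliminated by noting that it is orthogonal to `𝛌` and to its velocity, so that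
their cross product, `planeNormal a ȧ` up to a factor, is a multiple of it. What remains is a cubic
form in the initial velocity, `criterion`, that vanishes whenever `𝛌` stays in any plane through
the origin. If `𝛌 ≠ 0`, an explicit velocity shows that the form is not zero
(`exists_criterion_ne_zero`), and its zeros then form a null set in the tangent space by Fubini
along lines. Since `𝛌 ≠ 0` almost everywhere, the velocities with nonzero criterion form an open set
with null complement, and such a set is dense. The statement on great circles follows, as the
position of a lump with `𝛌 ≠ 0` is `-𝛌 / λ` (`eq_of_isLumpPosition`).
-/

namespace Lump

open Filter Topology

/-! ### The metric as a function of matrices -/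

/-- The complex `2 × 2` matrices, as coefficients of degree one maps and of tangent vectors. -/
abbrev Mat : Type := Matrix (Fin 2) (Fin 2) ℂ

/-- The `L²` metric as a function of matrices. -/
def l2 (A X Y : Mat) : ℝ := gam A X Y

/-- The integrand of the `L²` metric. -/
def l2Integrand (A X Y : Mat) (z : ℂ) : ℝ :=
  (wedge (A *ᵥ ![z, 1]) (X *ᵥ ![z, 1]) * star (wedge (A *ᵥ ![z, 1]) (Y *ᵥ ![z, 1]))).re /
    nsq (A *ᵥ ![z, 1]) ^ 2 / (1 + ‖z‖ ^ 2) ^ 2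

theorem l2_eq (A X Y : Mat) : l2 A X Y = ∫ z : ℂ, l2Integrand A X Y z := rfl

/-! ### Pointwise identities and estimates -/

theorem nsq_nonneg (v : Fin 2 → ℂ) : 0 ≤ nsq v := by unfold nsq; positivity

theorem nsq_pos {v : Fin 2 → ℂ} (hv : v ≠ 0) : 0 < nsq v := by
  refine lt_of_le_of_ne (nsq_nonneg v) fun h => hv ?_
  unfold nsq at h
  have h0 : ‖v 0‖ ^ 2 = 0 := by nlinarith [sq_nonneg ‖v 0‖, sq_nonneg ‖v 1‖]
  have h1 : ‖v 1‖ ^ 2 = 0 := by nlinarith [sq_nonneg ‖v 0‖, sq_nonneg ‖v 1‖]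
  funext i
  fin_cases i
  · simpa using h0
  · simpa using h1

theorem nsq_affine (z : ℂ) : nsq ![z, 1] = 1 + ‖z‖ ^ 2 := by simp [nsq, add_comm]

theorem ofReal_nsq (v : Fin 2 → ℂ) : ((nsq v : ℝ) : ℂ) = star v ⬝ᵥ v := by
  have h0 := Complex.conj_mul' (v 0)
  have h1 := Complex.conj_mul' (v 1)
  simp only [nsq, dotProduct, Fin.sum_univ_two, Pi.star_apply, RCLike.star_def, h0, h1]
  push_cast; ring

theorem wedge_mulVec (V : Mat) (u w : Fin 2 → ℂ) :
    wedge (V *ᵥ u) (V *ᵥ w) = V.det * wedge u w := by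
  simp [wedge, mulVec, dotProduct, Fin.sum_univ_two, det_fin_two]; ring

/-- A matrix `V` with `Vᴴ V = s` scales the squared length by `s`. -/
theorem nsq_mulVec_of_conformal {V : Mat} {s : ℝ} (hV : Vᴴ * V = (s : ℂ) • 1)
    (u : Fin 2 → ℂ) : nsq (V *ᵥ u) = s * nsq u := by
  have : ((nsq (V *ᵥ u) : ℝ) : ℂ) = ((s * nsq u : ℝ) : ℂ) := by
    push_cast
    rw [ofReal_nsq, ofReal_nsq, star_mulVec, dotProduct_mulVec, vecMul_vecMul, hV,
      vecMul_smul, vecMul_one, smul_dotProduct, smul_eq_mul]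
  exact_mod_cast this

theorem norm_det_sq_of_conformal {V : Mat} {s : ℝ} (hV : Vᴴ * V = (s : ℂ) • 1) :
    ‖V.det‖ ^ 2 = s ^ 2 := by
  have h := congrArg Matrix.det hV
  rw [det_mul, det_conjTranspose, det_smul, det_one] at h
  have h1 := Complex.conj_mul' V.det
  simp only [RCLike.star_def] at h
  rw [h1] at h
  simp at h
  exact_mod_cast h

theorem re_mul_star_mul (c p q : ℂ) :
    (c * p * star (c * q)).re = ‖c‖ ^ 2 * (p * star q).re := by
  have h1 := Complex.mul_conj' c
  have : c * p * star (c * q) = ((‖c‖ ^ 2 : ℝ) : ℂ) * (p * star q) := by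
    push_cast
    rw [← h1, star_mul']
    simp only [RCLike.star_def]; ring
  rw [this, Complex.re_ofReal_mul]

/-- The squared Frobenius norm. -/
def frobSq (M : Mat) : ℝ := ‖M 0 0‖ ^ 2 + ‖M 0 1‖ ^ 2 + ‖M 1 0‖ ^ 2 + ‖M 1 1‖ ^ 2

theorem frobSq_nonneg (M : Mat) : 0 ≤ frobSq M := by unfold frobSq; positivity

theorem frobSq_adjugate (M : Mat) : frobSq M.adjugate = frobSq M := by
  simp [frobSq, adjugate_fin_two]; ring

theorem norm_sq_dot_le (p q x y : ℂ) :
    ‖p * x + q * y‖ ^ 2 ≤ (‖p‖ ^ 2 + ‖q‖ ^ 2) * (‖x‖ ^ 2 + ‖y‖ ^ 2) := by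
  have h := norm_add_le (p * x) (q * y)
  rw [norm_mul, norm_mul] at h
  have h2 : ‖p * x + q * y‖ ^ 2 ≤ (‖p‖ * ‖x‖ + ‖q‖ * ‖y‖) ^ 2 := by gcongr
  nlinarith [sq_nonneg (‖p‖ * ‖y‖ - ‖q‖ * ‖x‖)]

theorem nsq_mulVec_le (M : Mat) (v : Fin 2 → ℂ) : nsq (M *ᵥ v) ≤ frobSq M * nsq v := by
  have h0 := norm_sq_dot_le (M 0 0) (M 0 1) (v 0) (v 1)
  have h1 := norm_sq_dot_le (M 1 0) (M 1 1) (v 0) (v 1)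
  simp only [nsq, frobSq, mulVec, dotProduct, Fin.sum_univ_two]
  nlinarith

theorem norm_wedge_sq_le (u w : Fin 2 → ℂ) : ‖wedge u w‖ ^ 2 ≤ nsq u * nsq w := by
  have h := norm_sq_dot_le (u 1) (-u 0) (w 0) (w 1)
  rw [norm_neg] at h
  simp only [wedge, nsq]
  calc _ = ‖u 1 * w 0 + -u 0 * w 1‖ ^ 2 := by congr 2; ring
    _ ≤ _ := h.trans (by linarith)

theorem le_nsq_mulVec (A : Mat) (v : Fin 2 → ℂ) :
    ‖A.det‖ ^ 2 * nsq v ≤ frobSq A * nsq (A *ᵥ v) := by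
  have h := nsq_mulVec_le A.adjugate (A *ᵥ v)
  rw [mulVec_mulVec, adjugate_mul, frobSq_adjugate] at h
  refine le_trans (le_of_eq ?_) h
  simp [nsq, smul_mulVec, mul_pow]; ring

theorem frobSq_pos {A : Mat} (hA : A.det ≠ 0) : 0 < frobSq A := by
  have h := le_nsq_mulVec A ![0, 1]
  rw [nsq_affine] at h
  have h1 : 0 < ‖A.det‖ ^ 2 := by positivity
  refine lt_of_le_of_ne (frobSq_nonneg A) fun h0 => ?_
  rw [← h0] at h
  simp at h
  exact hA h

theorem nsq_mulVec_pos {A : Mat} (hA : A.det ≠ 0) {v : Fin 2 → ℂ} (hv : v ≠ 0) :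
    0 < nsq (A *ᵥ v) := by
  have h := le_nsq_mulVec A v
  have h1 : 0 < ‖A.det‖ ^ 2 * nsq v := mul_pos (by positivity) (nsq_pos hv)
  have h2 := frobSq_pos hA
  by_contra h3
  nlinarith

theorem affine_ne_zero (z : ℂ) : (![z, 1] : Fin 2 → ℂ) ≠ 0 := fun h => by
  simpa using congrFun h 1

/-- A bound for the integrand of the metric that is locally uniform in its arguments. -/
def l2Bound (A X Y : Mat) : ℝ := (frobSq X + frobSq Y) * frobSq A / ‖A.det‖ ^ 2

theorem norm_l2Integrand_le {A : Mat} (hA : A.det ≠ 0) (X Y : Mat) (z : ℂ) :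
    ‖l2Integrand A X Y z‖ ≤ l2Bound A X Y * (((1 : ℝ) + ‖z‖ ^ 2) ^ 2)⁻¹ := by
  set v : Fin 2 → ℂ := ![z, 1] with hv
  have hn := nsq_mulVec_pos hA (affine_ne_zero z)
  have hd : 0 < ‖A.det‖ ^ 2 := by positivity
  have hX := norm_wedge_sq_le (A *ᵥ v) (X *ᵥ v)
  have hY := norm_wedge_sq_le (A *ᵥ v) (Y *ᵥ v)
  have hX' := nsq_mulVec_le X v
  have hY' := nsq_mulVec_le Y v
  have hA' := le_nsq_mulVec A v
  rw [← hv] at hn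
  set n := nsq (A *ᵥ v)
  set p := wedge (A *ᵥ v) (X *ᵥ v)
  set q := wedge (A *ᵥ v) (Y *ᵥ v)
  have h1 : |(p * star q).re| ≤ ‖p‖ * ‖q‖ := by
    refine (Complex.abs_re_le_norm _).trans ?_
    rw [norm_mul, norm_star]
  have h2 : |(p * star q).re| ≤ n * ((frobSq X + frobSq Y) * nsq v) := by
    have h3 : ‖p‖ ^ 2 ≤ n * (frobSq X * nsq v) := hX.trans (by gcongr)
    have h4 : ‖q‖ ^ 2 ≤ n * (frobSq Y * nsq v) := hY.trans (by gcongr)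
    have h5 : 0 ≤ ‖p‖ ^ 2 + ‖q‖ ^ 2 := by positivity
    nlinarith [sq_nonneg (‖p‖ - ‖q‖)]
  have h6 : |(p * star q).re| / n ^ 2 ≤ l2Bound A X Y := by
    rw [l2Bound, div_le_div_iff₀ (by positivity) hd]
    have hXY : 0 ≤ frobSq X + frobSq Y := add_nonneg (frobSq_nonneg X) (frobSq_nonneg Y)
    calc |(p * star q).re| * ‖A.det‖ ^ 2
        ≤ n * ((frobSq X + frobSq Y) * nsq v) * ‖A.det‖ ^ 2 := by gcongr
      _ = n * (frobSq X + frobSq Y) * (‖A.det‖ ^ 2 * nsq v) := by ring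
      _ ≤ n * (frobSq X + frobSq Y) * (frobSq A * n) := by gcongr
      _ = _ := by ring
  have h7 : ‖l2Integrand A X Y z‖ = |(p * star q).re| / n ^ 2 * (((1 : ℝ) + ‖z‖ ^ 2) ^ 2)⁻¹ := by
    rw [l2Integrand, Real.norm_eq_abs, abs_div, abs_div, div_eq_mul_inv _ (|(1 + ‖z‖ ^ 2) ^ 2|),
      abs_of_nonneg (a := nsq _ ^ 2) (sq_nonneg _),
      abs_of_nonneg (a := (1 + ‖z‖ ^ 2) ^ 2) (sq_nonneg _)]
  rw [h7]
  gcongr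

theorem integrable_inv_sq : Integrable (fun z : ℂ => (((1 : ℝ) + ‖z‖ ^ 2) ^ 2)⁻¹) := by
  have h := integrable_rpow_neg_one_add_norm_sq (E := ℂ) (μ := volume) (r := 4)
    (by rw [Complex.finrank_real_complex]; norm_num)
  refine h.congr (Eventually.of_forall fun z => ?_)
  have : (-4 / 2 : ℝ) = -(2 : ℕ) := by norm_num
  simp only [this]
  rw [Real.rpow_neg (by positivity), Real.rpow_natCast]

theorem continuous_nsq : Continuous nsq := by unfold nsq; fun_prop

theorem continuous_wedge : Continuous fun p : (Fin 2 → ℂ) × (Fin 2 → ℂ) => wedge p.1 p.2 := by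
  unfold wedge; fun_prop

theorem continuousAt_l2Integrand (p : (Mat × Mat × Mat) × ℂ) (h : p.1.1.det ≠ 0) :
    ContinuousAt (fun p : (Mat × Mat × Mat) × ℂ => l2Integrand p.1.1 p.1.2.1 p.1.2.2 p.2) p := by
  have hn := (nsq_mulVec_pos h (affine_ne_zero p.2)).ne'
  have hv : Continuous fun p : (Mat × Mat × Mat) × ℂ => (![p.2, 1] : Fin 2 → ℂ) := by fun_prop
  have hA : Continuous fun p : (Mat × Mat × Mat) × ℂ => p.1.1 *ᵥ ![p.2, 1] :=
    Continuous.matrix_mulVec (by fun_prop) hv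
  have hX : Continuous fun p : (Mat × Mat × Mat) × ℂ => p.1.2.1 *ᵥ ![p.2, 1] :=
    Continuous.matrix_mulVec (by fun_prop) hv
  have hY : Continuous fun p : (Mat × Mat × Mat) × ℂ => p.1.2.2 *ᵥ ![p.2, 1] :=
    Continuous.matrix_mulVec (by fun_prop) hv
  have w1 := continuous_wedge.comp (hA.prodMk hX)
  have w2 := continuous_wedge.comp (hA.prodMk hY)
  have n1 := continuous_nsq.comp hA
  unfold l2Integrand
  refine ContinuousAt.div (ContinuousAt.div ?_ ?_ ?_) ?_ ?_
  · exact (Complex.continuous_re.comp (w1.mul w2.star)).continuousAt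
  · exact (n1.pow 2).continuousAt
  · exact pow_ne_zero _ hn
  · fun_prop
  · positivity

theorem continuous_l2Integrand {A : Mat} (hA : A.det ≠ 0) (X Y : Mat) :
    Continuous (l2Integrand A X Y) := by
  rw [continuous_iff_continuousAt]
  intro z
  exact (continuousAt_l2Integrand ((A, X, Y), z) hA).comp
    (f := fun z : ℂ => ((A, X, Y), z)) (by fun_prop)

theorem integrable_l2Integrand {A : Mat} (hA : A.det ≠ 0) (X Y : Mat) :
    Integrable (l2Integrand A X Y) :=
  (integrable_inv_sq.const_mul (l2Bound A X Y)).mono'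
    (continuous_l2Integrand hA X Y).aestronglyMeasurable
    (Eventually.of_forall (norm_l2Integrand_le hA X Y))

/-! ### The metric is a continuous family of symmetric bilinear forms -/

theorem l2_symm (A X Y : Mat) : l2 A X Y = l2 A Y X := by
  rw [l2_eq, l2_eq]
  congr 1; funext z
  unfold l2Integrand
  congr 2
  rw [← Complex.conj_re]
  simp [mul_comm]

theorem wedge_add_right (u v w : Fin 2 → ℂ) : wedge u (v + w) = wedge u v + wedge u w := by
  simp [wedge]; ring

theorem wedge_smul_right (c : ℂ) (u v : Fin 2 → ℂ) : wedge u (c • v) = c * wedge u v := by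
  simp [wedge]; ring

theorem l2_add_right {A : Mat} (hA : A.det ≠ 0) (X Y Z : Mat) :
    l2 A X (Y + Z) = l2 A X Y + l2 A X Z := by
  rw [l2_eq, l2_eq, l2_eq,
    ← integral_add (integrable_l2Integrand hA X Y) (integrable_l2Integrand hA X Z)]
  congr 1; funext z
  unfold l2Integrand
  rw [add_mulVec, wedge_add_right, star_add, mul_add, Complex.add_re, add_div, add_div]

theorem l2_smul_right (A X Y : Mat) (r : ℝ) : l2 A X ((r : ℂ) • Y) = r * l2 A X Y := by
  rw [l2_eq, l2_eq, ← integral_const_mul]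
  congr 1; funext z
  unfold l2Integrand
  rw [smul_mulVec, wedge_smul_right, star_mul', RCLike.star_def, Complex.conj_ofReal,
    mul_left_comm, Complex.re_ofReal_mul, mul_div_assoc, mul_div_assoc]

theorem l2_add_left {A : Mat} (hA : A.det ≠ 0) (X Y Z : Mat) :
    l2 A (X + Y) Z = l2 A X Z + l2 A Y Z := by
  rw [l2_symm, l2_add_right hA, l2_symm A Z X, l2_symm A Z Y]

theorem l2_smul_left (A X Y : Mat) (r : ℝ) : l2 A ((r : ℂ) • X) Y = r * l2 A X Y := by
  rw [l2_symm, l2_smul_right, l2_symm A Y X]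

/-- The functional `l2 A X` on matrices. -/
def l2Right {A : Mat} (hA : A.det ≠ 0) (X : Mat) : Mat →ₗ[ℝ] ℝ where
  toFun := l2 A X
  map_add' := l2_add_right hA X
  map_smul' r Y := by
    rw [RingHom.id_apply, smul_eq_mul, ← l2_smul_right]
    congr 1

theorem l2_sub_right {A : Mat} (hA : A.det ≠ 0) (X Y Z : Mat) :
    l2 A X (Y - Z) = l2 A X Y - l2 A X Z := (l2Right hA X).map_sub Y Z

theorem l2_zero_right (A X : Mat) : l2 A X 0 = 0 := by
  simpa using l2_smul_right A X 0 0

theorem continuousAt_l2 (q : Mat × Mat × Mat) (h : q.1.det ≠ 0) :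
    ContinuousAt (fun q : Mat × Mat × Mat => l2 q.1 q.2.1 q.2.2) q := by
  have hdet : ∀ᶠ p : Mat × Mat × Mat in 𝓝 q, p.1.det ≠ 0 :=
    (Continuous.matrix_det continuous_fst).continuousAt.eventually_ne h
  have hB : ContinuousAt (fun q : Mat × Mat × Mat => l2Bound q.1 q.2.1 q.2.2) q := by
    unfold l2Bound frobSq
    refine ContinuousAt.div (by fun_prop) ?_ (by positivity)
    exact ((Continuous.matrix_det continuous_fst).norm.pow 2).continuousAt
  have hB' : ∀ᶠ p : Mat × Mat × Mat in 𝓝 q,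
      l2Bound p.1 p.2.1 p.2.2 < l2Bound q.1 q.2.1 q.2.2 + 1 :=
    hB.eventually (gt_mem_nhds (by linarith))
  -- The dominated convergence theorem needs a countable basis of neighbourhoods.
  have : FirstCountableTopology Mat :=
    inferInstanceAs (FirstCountableTopology (Fin 2 → Fin 2 → ℂ))
  simp only [l2_eq]
  refine continuousAt_of_dominated
    (bound := fun z => (l2Bound q.1 q.2.1 q.2.2 + 1) * (((1 : ℝ) + ‖z‖ ^ 2) ^ 2)⁻¹) ?_ ?_
    (integrable_inv_sq.const_mul _) ?_
  · filter_upwards [hdet] with p hp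
    exact (continuous_l2Integrand hp _ _).aestronglyMeasurable
  · filter_upwards [hdet, hB'] with p hp hp'
    refine Eventually.of_forall fun z => (norm_l2Integrand_le hp _ _ z).trans ?_
    gcongr
  · refine Eventually.of_forall fun z => ?_
    exact (continuousAt_l2Integrand (q, z) h).comp
      (f := fun p : Mat × Mat × Mat => (p, z)) (by fun_prop)

/-! ### Isometries -/

/-- Rotations of the target sphere are isometries. -/
theorem l2_mul_left {V : Mat} {s : ℝ} (hs : 0 < s) (hV : Vᴴ * V = (s : ℂ) • 1) (A X Y : Mat) :
    l2 (V * A) (V * X) (V * Y) = l2 A X Y := by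
  rw [l2_eq, l2_eq]
  congr 1; funext z
  unfold l2Integrand
  simp only [← mulVec_mulVec]
  rw [wedge_mulVec, wedge_mulVec, nsq_mulVec_of_conformal hV, re_mul_star_mul,
    norm_det_sq_of_conformal hV, mul_pow, mul_div_mul_left _ _ (by positivity)]

/-- The integrand is a function of degree zero in homogeneous coordinates, times the area form. -/
theorem l2Integrand_eq_of_smul (A X Y : Mat) (c z : ℂ) (hc : c ≠ 0) (v : Fin 2 → ℂ)
    (hv : v = c • ![z, 1]) :
    l2Integrand A X Y z = (wedge (A *ᵥ v) (X *ᵥ v) * star (wedge (A *ᵥ v) (Y *ᵥ v))).re /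
      nsq (A *ᵥ v) ^ 2 / (1 + ‖z‖ ^ 2) ^ 2 := by
  have hw : ∀ x y : Fin 2 → ℂ, wedge (c • x) (c • y) = c ^ 2 * wedge x y := by
    intro x y; simp [wedge]; ring
  have hn : ∀ x : Fin 2 → ℂ, nsq (c • x) = ‖c‖ ^ 2 * nsq x := by
    intro x; simp [nsq]; ring
  have : ‖c‖ ^ 2 ≠ 0 := by positivity
  rw [hv, mulVec_smul, mulVec_smul, mulVec_smul, hw, hw, hn, re_mul_star_mul, norm_pow, mul_pow,
    mul_div_mul_left _ _ (by positivity), l2Integrand]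

/-! ### Möbius transformations of the domain -/

/-- The Möbius transformation `z ↦ (V₀₀ z + V₀₁) / (V₁₀ z + V₁₁)`. -/
def mobius (V : Mat) (z : ℂ) : ℂ := (V 0 0 * z + V 0 1) / (V 1 0 * z + V 1 1)

theorem mulVec_affine_eq (V : Mat) {z : ℂ} (hz : V 1 0 * z + V 1 1 ≠ 0) :
    V *ᵥ ![z, 1] = (V 1 0 * z + V 1 1) • ![mobius V z, 1] := by
  funext i
  fin_cases i
  · simp [mobius, mulVec, dotProduct, Fin.sum_univ_two, mul_div_cancel₀ _ hz]
  · simp [mulVec, dotProduct, Fin.sum_univ_two]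

theorem hasDerivAt_mobius (V : Mat) {z : ℂ} (hz : V 1 0 * z + V 1 1 ≠ 0) :
    HasDerivAt (mobius V) (V.det / (V 1 0 * z + V 1 1) ^ 2) z := by
  have h0 : HasDerivAt (fun z : ℂ => V 0 0 * z + V 0 1) (V 0 0) z := by
    simpa using! ((hasDerivAt_id z).const_mul (V 0 0)).add_const (V 0 1)
  have h1 : HasDerivAt (fun z : ℂ => V 1 0 * z + V 1 1) (V 1 0) z := by
    simpa using! ((hasDerivAt_id z).const_mul (V 1 0)).add_const (V 1 1)
  have h := h0.div h1 hz
  have he : (V 0 0 * (V 1 0 * z + V 1 1) - (V 0 0 * z + V 0 1) * V 1 0) = V.det := by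
    rw [det_fin_two]; ring
  rw [he] at h
  exact h

theorem mobius_comp {V W : Mat} (z : ℂ) (hz : V 1 0 * z + V 1 1 ≠ 0)
    (hWV : W * V = 1) :
    W 1 0 * mobius V z + W 1 1 ≠ 0 ∧ mobius W (mobius V z) = z := by
  have e00 := congrFun (congrFun hWV 0) 0
  have e01 := congrFun (congrFun hWV 0) 1
  have e10 := congrFun (congrFun hWV 1) 0
  have e11 := congrFun (congrFun hWV 1) 1
  simp [Matrix.mul_apply, Fin.sum_univ_two] at e00 e01 e10 e11
  have hz' : z * V 1 0 + V 1 1 ≠ 0 := by rwa [mul_comm z]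
  have h1 : W 1 0 * mobius V z + W 1 1 = 1 / (V 1 0 * z + V 1 1) := by
    rw [mobius]; field_simp; linear_combination z * e10 + e11
  have h2 : W 0 0 * mobius V z + W 0 1 = z / (V 1 0 * z + V 1 1) := by
    rw [mobius]; field_simp; linear_combination z * e00 + e01
  refine ⟨by rw [h1]; exact one_div_ne_zero hz, ?_⟩
  rw [mobius, h1, h2]; field_simp

theorem volume_affine_zero_eq_zero {c d : ℂ} (h : c ≠ 0 ∨ d ≠ 0) :
    volume {z : ℂ | c * z + d ≠ 0}ᶜ = 0 := by
  refine Set.Subsingleton.measure_zero (fun x hx y hy => ?_) _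
  simp only [mem_compl_iff, mem_ofPred_eq, not_not] at hx hy
  by_cases hc : c = 0
  · subst hc
    simp at hx h
    exact absurd hx h
  · exact mul_left_cancel₀ hc (by linear_combination hx - hy)

theorem abs_det_fderiv_mobius (w : ℂ) :
    |((ContinuousLinearMap.toSpanSingleton ℂ w).restrictScalars ℝ).det| = ‖w‖ ^ 2 := by
  have : ((ContinuousLinearMap.toSpanSingleton ℂ w).restrictScalars ℝ).det = ‖w‖ ^ 2 := by
    rw [ContinuousLinearMap.det]
    erw [LinearMap.det_restrictScalars]
    rw [Algebra.norm_complex_apply, Complex.normSq_eq_norm_sq]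
    simp [LinearMap.det_ring]
  rw [this, abs_of_nonneg (by positivity)]

theorem row_ne_zero {V : Mat} (hV : V.det ≠ 0) : V 1 0 ≠ 0 ∨ V 1 1 ≠ 0 := by
  by_contra! h
  exact hV (by rw [det_fin_two, h.1, h.2]; ring)

/-- Rotations of the domain sphere are isometries: the area form of the round sphere is invariant
under Möbius transformations induced by unitary matrices. -/
theorem l2_mul_right {V : Mat} {s : ℝ} (hs : 0 < s) (hV : Vᴴ * V = (s : ℂ) • 1) (A X Y : Mat) :
    l2 (A * V) (X * V) (Y * V) = l2 A X Y := by
  have hdet2 := norm_det_sq_of_conformal hV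
  have hdet : V.det ≠ 0 := by
    intro h
    rw [h] at hdet2
    simp at hdet2
    exact (pow_pos hs 2).ne hdet2
  have hVi : V⁻¹ * V = 1 := nonsing_inv_mul _ (by simpa using hdet)
  have hVi' : V * V⁻¹ = 1 := mul_nonsing_inv _ (by simpa using hdet)
  have hidet : (V⁻¹).det ≠ 0 := fun h => by
    have := congrArg Matrix.det hVi
    rw [det_mul, h] at this
    simp at this
  set S : Set ℂ := {z | V 1 0 * z + V 1 1 ≠ 0} with hS
  set S' : Set ℂ := {z | V⁻¹ 1 0 * z + V⁻¹ 1 1 ≠ 0} with hS'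
  have hSm : MeasurableSet S := by
    have : IsOpen S := isOpen_ne_fun (by fun_prop) (by fun_prop)
    exact this.measurableSet
  have himg : mobius V '' S = S' := by
    ext w
    constructor
    · rintro ⟨z, hz, rfl⟩
      exact (mobius_comp z hz hVi).1
    · intro hw
      have := mobius_comp w hw hVi'
      exact ⟨mobius V⁻¹ w, this.1, this.2⟩
  have hinj : InjOn (mobius V) S := by
    intro x hx y hy hxy
    rw [← (mobius_comp x hx hVi).2, hxy, (mobius_comp y hy hVi).2]
  have key := integral_image_eq_integral_abs_det_fderiv_smul volume hSm
    (fun z hz => ((hasDerivAt_mobius V hz).hasFDerivAt.restrictScalars ℝ).hasFDerivWithinAt)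
    hinj (l2Integrand A X Y)
  rw [himg, setIntegral_eq_integral_of_ae_compl_eq_zero, setIntegral_congr_fun hSm
    (g := l2Integrand (A * V) (X * V) (Y * V)), setIntegral_eq_integral_of_ae_compl_eq_zero] at key
  · rw [l2_eq, l2_eq, key]
  · have h0 := volume_affine_zero_eq_zero (row_ne_zero hdet)
    have h1 : ∀ᵐ z : ℂ, z ∈ S := by rw [ae_iff]; exact h0
    filter_upwards [h1] with z hz hz'
    exact absurd hz hz'
  · intro z hz
    have hz' : V 1 0 * z + V 1 1 ≠ 0 := hz
    simp only
    rw [abs_det_fderiv_mobius, l2Integrand_eq_of_smul A X Y _ _ hz _ (mulVec_affine_eq V hz),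
      l2Integrand, mulVec_mulVec, mulVec_mulVec, mulVec_mulVec, smul_eq_mul]
    have hn := nsq_mulVec_of_conformal hV ![z, 1]
    rw [mulVec_affine_eq V hz, nsq_affine] at hn
    have h3 : nsq ((V 1 0 * z + V 1 1) • ![mobius V z, 1]) =
        ‖V 1 0 * z + V 1 1‖ ^ 2 * (1 + ‖mobius V z‖ ^ 2) := by
      simp [nsq]; ring
    rw [h3] at hn
    have hne : ‖V 1 0 * z + V 1 1‖ ≠ 0 := by positivity
    have h4 : 1 + ‖mobius V z‖ ^ 2 = s * (1 + ‖z‖ ^ 2) / ‖V 1 0 * z + V 1 1‖ ^ 2 := by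
      rw [← hn]; field_simp
    rw [h4, norm_div, norm_pow, div_pow, hdet2]
    generalize (wedge _ _ * star _).re / nsq _ ^ 2 = t
    have : (1 : ℝ) + ‖z‖ ^ 2 ≠ 0 := by positivity
    field_simp
  · have h0 := volume_affine_zero_eq_zero (row_ne_zero hidet)
    have h1 : ∀ᵐ z : ℂ, z ∈ S' := by rw [ae_iff]; exact h0
    filter_upwards [h1] with z hz hz'
    exact absurd hz hz'

/-! ### The metric at a matrix with orthogonal columns -/

/-- The radial weight of the metric at a matrix `A` with `Aᴴ A = diag(b, d)`. -/
def radialWeight (b d r : ℝ) : ℝ := 1 / ((b * r ^ 2 + d) ^ 2 * (1 + r ^ 2) ^ 2)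

theorem nsq_mulVec_of_diagonal {A : Mat} {b d : ℝ} (hA : Aᴴ * A = !![(b : ℂ), 0; 0, (d : ℂ)])
    (z : ℂ) : nsq (A *ᵥ ![z, 1]) = b * ‖z‖ ^ 2 + d := by
  have h : ((nsq (A *ᵥ ![z, 1]) : ℝ) : ℂ) = ((b * ‖z‖ ^ 2 + d : ℝ) : ℂ) := by
    rw [ofReal_nsq, star_mulVec, dotProduct_mulVec, vecMul_vecMul, hA]
    have := Complex.conj_mul' z
    push_cast
    rw [← this]
    simp [vecMul, dotProduct, Fin.sum_univ_two]
    ring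
  exact_mod_cast h

theorem l2Integrand_of_diagonal {A : Mat} {b d : ℝ} (hA : Aᴴ * A = !![(b : ℂ), 0; 0, (d : ℂ)])
    (ξ η : Mat) (z : ℂ) :
    l2Integrand A (A * ξ) (A * η) z = ‖A.det‖ ^ 2 *
      ((ξ 0 1 + (ξ 0 0 - ξ 1 1) * z - ξ 1 0 * z ^ 2) *
        star (η 0 1 + (η 0 0 - η 1 1) * z - η 1 0 * z ^ 2)).re * radialWeight b d ‖z‖ := by
  have hw : ∀ ξ : Mat, wedge ![z, 1] (ξ *ᵥ ![z, 1]) =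
      ξ 0 1 + (ξ 0 0 - ξ 1 1) * z - ξ 1 0 * z ^ 2 := by
    intro ξ
    simp [wedge, mulVec, dotProduct, Fin.sum_univ_two]; ring
  rw [l2Integrand, nsq_mulVec_of_diagonal hA, ← mulVec_mulVec, ← mulVec_mulVec, wedge_mulVec,
    wedge_mulVec, re_mul_star_mul, hw, hw, radialWeight]
  rw [div_div, mul_one_div]

/-- The integral of a function over the plane is unchanged by averaging it over the quarter
turns. -/
theorem integral_eq_integral_average {f : ℂ → ℝ} (hf : Integrable f) :
    ∫ z, f z = ∫ z, (f z + f (Complex.I * z) + f (-z) + f (-(Complex.I * z))) / 4 := by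
  let e : ℂ ≃ₗᵢ[ℝ] ℂ := rotation ⟨Complex.I, by simp [Submonoid.unitSphere]⟩
  have he : ∀ z, e z = Complex.I * z := fun z => rfl
  have hemb := e.toHomeomorph.measurableEmbedding
  have h1 : ∫ z, f (Complex.I * z) = ∫ z, f z := e.measurePreserving.integral_comp hemb f
  have i1 : Integrable fun z => f (Complex.I * z) :=
    (e.measurePreserving.integrable_comp_emb hemb).2 hf
  have h2 : ∫ z, f (-z) = ∫ z, f z := integral_neg_eq_self f volume
  have i2 : Integrable fun z => f (-z) := hf.comp_neg
  have h3 : ∫ z, f (-(Complex.I * z)) = ∫ z, f z :=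
    (e.measurePreserving.integral_comp hemb (fun z => f (-z))).trans h2
  have i3 : Integrable fun z => f (-(Complex.I * z)) :=
    (e.measurePreserving.integrable_comp_emb hemb).2 i2
  have i01 : Integrable fun z => f z + f (Complex.I * z) := hf.add i1
  have i012 : Integrable fun z => f z + f (Complex.I * z) + f (-z) := i01.add i2
  rw [integral_div, integral_add i012 i3, integral_add i01 i2,
    integral_add hf i1, h1, h2, h3]
  ring

theorem average_quarter_turns (x0 x1 x2 y0 y1 y2 z : ℂ) :
    ((x0 + x1 * z - x2 * z ^ 2) * star (y0 + y1 * z - y2 * z ^ 2)).re +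
      ((x0 + x1 * (Complex.I * z) - x2 * (Complex.I * z) ^ 2) *
        star (y0 + y1 * (Complex.I * z) - y2 * (Complex.I * z) ^ 2)).re +
      ((x0 + x1 * (-z) - x2 * (-z) ^ 2) * star (y0 + y1 * (-z) - y2 * (-z) ^ 2)).re +
      ((x0 + x1 * (-(Complex.I * z)) - x2 * (-(Complex.I * z)) ^ 2) *
        star (y0 + y1 * (-(Complex.I * z)) - y2 * (-(Complex.I * z)) ^ 2)).re =
      4 * ((x0 * star y0).re + (x1 * star y1).re * ‖z‖ ^ 2 + (x2 * star y2).re * ‖z‖ ^ 4) := by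
  have h2 : ‖z‖ ^ 2 = z.re ^ 2 + z.im ^ 2 := by
    rw [← Complex.normSq_eq_norm_sq, Complex.normSq_apply]; ring
  have h4 : ‖z‖ ^ 4 = (z.re ^ 2 + z.im ^ 2) ^ 2 := by rw [← h2]; ring
  rw [h2, h4]
  simp [pow_two]
  ring

theorem radialWeight_pos {b d : ℝ} (hb : 0 < b) (hd : 0 < d) (r : ℝ) : 0 < radialWeight b d r := by
  unfold radialWeight; positivity

/-- The primitive `r² / (2 (b r² + d) (1 + r²))` of the radial integrand vanishes at both ends. -/
theorem integral_radial_eq_zero {b d : ℝ} (hb : 0 < b) (hd : 0 < d)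
    (hint : Integrable fun z : ℂ => (d - b * ‖z‖ ^ 4) * radialWeight b d ‖z‖) :
    ∫ z : ℂ, (d - b * ‖z‖ ^ 4) * radialWeight b d ‖z‖ = 0 := by
  rw [integral_fun_norm_addHaar volume (fun r => (d - b * r ^ 4) * radialWeight b d r)]
  have hint' := (integrable_fun_norm_addHaar volume
    (f := fun r => (d - b * r ^ 4) * radialWeight b d r)).1 hint
  rw [Complex.finrank_real_complex] at hint' ⊢
  have hderiv : ∀ r ∈ Ici (0 : ℝ), HasDerivAt
      (fun r : ℝ => r ^ 2 / (2 * ((b * r ^ 2 + d) * (1 + r ^ 2))))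
      (r ^ (2 - 1) • ((d - b * r ^ 4) * radialWeight b d r)) r := by
    intro r _
    have hp : HasDerivAt (fun r : ℝ => r ^ 2) (2 * r) r := by simpa using hasDerivAt_pow 2 r
    have h1 : b * r ^ 2 + d ≠ 0 := by positivity
    have h2 : 1 + r ^ 2 ≠ 0 := by positivity
    have h := hp.div ((((hp.const_mul b).add_const d).mul (hp.const_add 1)).const_mul 2)
      (mul_ne_zero two_ne_zero (mul_ne_zero h1 h2))
    refine h.congr_deriv ?_
    simp only [radialWeight, Pi.mul_apply, smul_eq_mul]
    field_simp
    ring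
  have hlim : Tendsto (fun r : ℝ => r ^ 2 / (2 * ((b * r ^ 2 + d) * (1 + r ^ 2)))) atTop (𝓝 0) := by
    have h1 : Tendsto (fun r : ℝ => (1 / b) * (1 + r ^ 2)⁻¹) atTop (𝓝 0) := by
      have h2 : Tendsto (fun r : ℝ => 1 + r ^ 2) atTop atTop :=
        tendsto_atTop_add_const_left _ _ (tendsto_pow_atTop two_ne_zero)
      simpa using h2.inv_tendsto_atTop.const_mul (1 / b)
    refine squeeze_zero (fun r => by positivity) (fun r => ?_) h1
    rw [← div_eq_mul_inv, div_div, div_le_div_iff₀ (by positivity) (by positivity)]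
    have : 0 ≤ r ^ 2 := sq_nonneg r
    nlinarith [mul_nonneg hb.le (mul_nonneg this this), mul_nonneg hb.le this,
      mul_nonneg hd.le this]
  have := integral_Ioi_of_hasDerivAt_of_tendsto' hderiv hint' hlim
  rw [this]
  simp

/-- The metric at a matrix with orthogonal columns is diagonal in the matrix entries, and the
coefficients of the two off-diagonal entries are in the ratio of the squared column lengths. -/
theorem exists_l2_of_diagonal {A : Mat} {b d : ℝ} (hA : Aᴴ * A = !![(b : ℂ), 0; 0, (d : ℂ)])
    (hb : 0 < b) (hd : 0 < d) (hdet : A.det ≠ 0) :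
    ∃ J I₁ : ℝ, 0 < J ∧ ∀ ξ η : Mat, l2 A (A * ξ) (A * η) =
      J * (b * (ξ 0 1 * star (η 0 1)).re + d * (ξ 1 0 * star (η 1 0)).re) +
        I₁ * ((ξ 0 0 - ξ 1 1) * star (η 0 0 - η 1 1)).re := by
  have hdet2 : ‖A.det‖ ^ 2 ≠ 0 := by positivity
  have i0 : Integrable fun z : ℂ => radialWeight b d ‖z‖ := by
    have := (integrable_l2Integrand hdet (A * !![0, 1; 0, 0]) (A * !![0, 1; 0, 0])).const_mul
      (‖A.det‖ ^ 2)⁻¹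
    refine this.congr (Eventually.of_forall fun z => ?_)
    simp [l2Integrand_of_diagonal hA, hdet]
  have i1 : Integrable fun z : ℂ => ‖z‖ ^ 2 * radialWeight b d ‖z‖ := by
    have := (integrable_l2Integrand hdet (A * !![1, 0; 0, 0]) (A * !![1, 0; 0, 0])).const_mul
      (‖A.det‖ ^ 2)⁻¹
    refine this.congr (Eventually.of_forall fun z => ?_)
    have h : ‖z‖ ^ 2 = z.re ^ 2 + z.im ^ 2 := by
      rw [← Complex.normSq_eq_norm_sq, Complex.normSq_apply]; ring
    simp only [l2Integrand_of_diagonal hA, h]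
    simp
    field_simp
  have i2 : Integrable fun z : ℂ => ‖z‖ ^ 4 * radialWeight b d ‖z‖ := by
    have := (integrable_l2Integrand hdet (A * !![0, 0; 1, 0]) (A * !![0, 0; 1, 0])).const_mul
      (‖A.det‖ ^ 2)⁻¹
    refine this.congr (Eventually.of_forall fun z => ?_)
    have h : ‖z‖ ^ 2 = z.re ^ 2 + z.im ^ 2 := by
      rw [← Complex.normSq_eq_norm_sq, Complex.normSq_apply]; ring
    have h4 : ‖z‖ ^ 4 = (z.re ^ 2 + z.im ^ 2) ^ 2 := by rw [← h]; ring
    simp only [l2Integrand_of_diagonal hA, h4]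
    simp [pow_two]
    field_simp
    ring
  set I0 := ∫ z : ℂ, radialWeight b d ‖z‖ with hI0
  set I1 := ∫ z : ℂ, ‖z‖ ^ 2 * radialWeight b d ‖z‖ with hI1
  set I2 := ∫ z : ℂ, ‖z‖ ^ 4 * radialWeight b d ‖z‖ with hI2
  have hrel : d * I0 = b * I2 := by
    have h := integral_radial_eq_zero hb hd
      (((i0.const_mul d).sub (i2.const_mul b)).congr (Eventually.of_forall fun z => by
        simp only [Pi.sub_apply]; ring))
    have h' : ∫ z : ℂ, (d * radialWeight b d ‖z‖ - b * (‖z‖ ^ 4 * radialWeight b d ‖z‖)) = 0 := by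
      rw [← h]; congr 1; funext z; ring
    rw [integral_sub (i0.const_mul d) (i2.const_mul b), integral_const_mul,
      integral_const_mul] at h'
    linarith
  have hpos : 0 < I0 := by
    rw [hI0, integral_pos_iff_support_of_nonneg (fun z => (radialWeight_pos hb hd _).le) i0]
    have : Function.support (fun z : ℂ => radialWeight b d ‖z‖) = univ := by
      ext z; simp [(radialWeight_pos hb hd ‖z‖).ne']
    rw [this]; simp
  have hsum : ∀ p q r : ℝ, ∫ z : ℂ, (p * radialWeight b d ‖z‖ +
      q * (‖z‖ ^ 2 * radialWeight b d ‖z‖) + r * (‖z‖ ^ 4 * radialWeight b d ‖z‖)) =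
      p * I0 + q * I1 + r * I2 := by
    intro p q r
    have i01 : Integrable fun z : ℂ => p * radialWeight b d ‖z‖ +
      q * (‖z‖ ^ 2 * radialWeight b d ‖z‖) := (i0.const_mul p).add (i1.const_mul q)
    rw [integral_add i01 (i2.const_mul r), integral_add (i0.const_mul p) (i1.const_mul q),
      integral_const_mul, integral_const_mul, integral_const_mul]
  refine ⟨‖A.det‖ ^ 2 * I0 / b, ‖A.det‖ ^ 2 * I1, by positivity, fun ξ η => ?_⟩
  have hI2' : I2 = d * I0 / b := by rw [hrel]; field_simp
  have hav : ∀ z : ℂ, (l2Integrand A (A * ξ) (A * η) z + l2Integrand A (A * ξ) (A * η) (Complex.I * z)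
      + l2Integrand A (A * ξ) (A * η) (-z) + l2Integrand A (A * ξ) (A * η) (-(Complex.I * z))) / 4 =
      ‖A.det‖ ^ 2 * (ξ 0 1 * star (η 0 1)).re * radialWeight b d ‖z‖ +
      ‖A.det‖ ^ 2 * ((ξ 0 0 - ξ 1 1) * star (η 0 0 - η 1 1)).re *
        (‖z‖ ^ 2 * radialWeight b d ‖z‖) +
      ‖A.det‖ ^ 2 * (ξ 1 0 * star (η 1 0)).re * (‖z‖ ^ 4 * radialWeight b d ‖z‖) := by
    intro z
    have h := average_quarter_turns (ξ 0 1) (ξ 0 0 - ξ 1 1) (ξ 1 0) (η 0 1) (η 0 0 - η 1 1) (η 1 0) z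
    simp only [l2Integrand_of_diagonal hA]
    have n1 : ‖Complex.I * z‖ = ‖z‖ := by simp
    rw [norm_neg, norm_neg, n1]
    linear_combination ‖A.det‖ ^ 2 * radialWeight b d ‖z‖ / 4 * h
  rw [l2_eq, integral_eq_integral_average (integrable_l2Integrand hdet _ _)]
  simp only [hav]
  rw [hsum, hI2']
  field_simp
  ring

/-! ### Diagonalization -/

open scoped ComplexOrder in
/-- A rotation of the domain makes the columns of `A` orthogonal. -/
theorem exists_diagonalization {A : Mat} (hA : A.det ≠ 0) :
    ∃ (V : Mat) (b d : ℝ), 0 < b ∧ 0 < d ∧ Vᴴ * V = 1 ∧ (A * V).det ≠ 0 ∧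
      (A * V)ᴴ * (A * V) = !![(b : ℂ), 0; 0, (d : ℂ)] ∧ (b = d → Aᴴ * A = (b : ℂ) • 1) := by
  have hH : (Aᴴ * A).IsHermitian := isHermitian_conjTranspose_mul_self A
  set V : Mat := (hH.eigenvectorUnitary : Mat) with hVdef
  have hV : Vᴴ * V = 1 := mem_unitaryGroup_iff'.1 hH.eigenvectorUnitary.2
  have hV' : V * Vᴴ = 1 := mul_eq_one_comm.1 hV
  obtain ⟨D, hD⟩ : ∃ D : Mat, D = Matrix.diagonal (RCLike.ofReal ∘ hH.eigenvalues) := ⟨_, rfl⟩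
  have hspec : Aᴴ * A = V * D * Vᴴ := by
    rw [hD]
    conv_lhs => rw [hH.spectral_theorem]
    simp [Unitary.conjStarAlgAut_apply, hVdef, star_eq_conjTranspose]
  have hdiag : (A * V)ᴴ * (A * V) =
      !![((hH.eigenvalues 0 : ℝ) : ℂ), 0; 0, ((hH.eigenvalues 1 : ℝ) : ℂ)] := by
    have : (A * V)ᴴ * (A * V) = D := by
      calc (A * V)ᴴ * (A * V) = Vᴴ * (Aᴴ * A) * V := by rw [conjTranspose_mul]; noncomm_ring
        _ = (Vᴴ * V) * D * (Vᴴ * V) := by rw [hspec]; noncomm_ring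
        _ = _ := by rw [hV, one_mul, mul_one]
    rw [this, hD]
    ext i j
    fin_cases i <;> fin_cases j <;> simp
  have hVdet : V.det ≠ 0 := fun h => by
    have := congrArg Matrix.det hV
    rw [det_mul, h] at this
    simp at this
  have hdetV : (A * V).det ≠ 0 := by rw [det_mul]; exact mul_ne_zero hA hVdet
  have hd : 0 < hH.eigenvalues 1 := by
    have h := nsq_mulVec_pos hdetV (affine_ne_zero 0)
    rw [nsq_mulVec_of_diagonal hdiag] at h
    simpa using h
  have hb0 : 0 ≤ hH.eigenvalues 0 := (posSemidef_conjTranspose_mul_self A).eigenvalues_nonneg 0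
  have hb : hH.eigenvalues 0 ≠ 0 := fun h => by
    have h1 := congrArg Matrix.det hdiag
    rw [det_mul, det_conjTranspose, h, det_fin_two_of] at h1
    simp at h1
    exact h1.elim hA hVdet
  refine ⟨V, _, _, lt_of_le_of_ne hb0 hb.symm, hd, hV, hdetV, hdiag, fun hbd => ?_⟩
  have h1 : Aᴴ * A = V * ((A * V)ᴴ * (A * V)) * Vᴴ := by
    calc Aᴴ * A = (V * Vᴴ) * (Aᴴ * A) * (V * Vᴴ) := by rw [hV', one_mul, mul_one]
      _ = _ := by rw [conjTranspose_mul]; noncomm_ring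
  have h2 : !![((hH.eigenvalues 0 : ℝ) : ℂ), 0; 0, ((hH.eigenvalues 0 : ℝ) : ℂ)] =
      ((hH.eigenvalues 0 : ℝ) : ℂ) • (1 : Mat) := by
    ext i j; fin_cases i <;> fin_cases j <;> simp
  rw [← hbd, h2] at hdiag
  refine h1.trans ?_
  rw [hdiag, mul_smul_comm, mul_one, smul_mul_assoc, hV']

theorem l2_mul_unitary {V : Mat} (hV : Vᴴ * V = 1) (A X Y : Mat) :
    l2 (A * V) (X * V) (Y * V) = l2 A X Y :=
  l2_mul_right one_pos (by simpa using hV) A X Y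

/-- On the vectors `A M` with `tr M = tr (Aᴴ A M) = 0`, the metric at `A` is proportional to the
Frobenius inner product. -/
theorem l2_eq_zero_of_trace {A : Mat} (hA : A.det ≠ 0) (hns : ∀ c : ℂ, Aᴴ * A ≠ c • 1)
    {X M : Mat} (htr : M.trace = 0) (hH : (Aᴴ * A * M).trace = 0)
    (h : (Mᴴ * Aᴴ * X).trace.re = 0) : l2 A X (A * M) = 0 := by
  obtain ⟨V, b, d, hb, hd, hV, hdet, hdiag, hscal⟩ := exists_diagonalization hA
  have hV' : V * Vᴴ = 1 := mul_eq_one_comm.1 hV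
  have hinv : A * V * (A * V)⁻¹ = 1 := mul_nonsing_inv _ (by simpa using hdet)
  obtain ⟨J, I₁, -, hl⟩ := exists_l2_of_diagonal hdiag hb hd hdet
  have hbd : b ≠ d := fun h => hns b (hscal h)
  set ξ : Mat := (A * V)⁻¹ * (X * V) with hξ
  set η : Mat := Vᴴ * M * V with hη
  have e1 : A * V * ξ = X * V := by rw [hξ, ← mul_assoc, hinv, one_mul]
  have e2 : A * V * η = A * M * V := by
    calc A * V * η = A * (V * Vᴴ) * M * V := by rw [hη]; noncomm_ring
      _ = _ := by rw [hV', mul_one]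
  have t1 : η.trace = 0 := by rw [hη, trace_mul_comm, ← mul_assoc, hV', one_mul, htr]
  have t2 : (!![(b : ℂ), 0; 0, (d : ℂ)] * η).trace = 0 := by
    rw [← hdiag]
    calc ((A * V)ᴴ * (A * V) * η).trace = (Vᴴ * (Aᴴ * (A * V * η))).trace := by
          rw [conjTranspose_mul]; congr 1; noncomm_ring
      _ = ((Vᴴ * (Aᴴ * A * M)) * V).trace := by rw [e2]; congr 1; noncomm_ring
      _ = _ := by rw [trace_mul_comm, ← mul_assoc, hV', one_mul, hH]
  have t3 : (ηᴴ * (!![(b : ℂ), 0; 0, (d : ℂ)] * ξ)).trace.re = 0 := by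
    rw [← hdiag]
    have : (ηᴴ * ((A * V)ᴴ * (A * V) * ξ)).trace = (Mᴴ * Aᴴ * X).trace := by
      calc _ = ((A * V * η)ᴴ * (A * V * ξ)).trace := by
            rw [conjTranspose_mul _ η]; congr 1; noncomm_ring
        _ = ((Vᴴ * (Mᴴ * Aᴴ * X)) * V).trace := by
            rw [e1, e2, conjTranspose_mul, conjTranspose_mul]; congr 1; noncomm_ring
        _ = _ := by rw [trace_mul_comm, ← mul_assoc, hV', one_mul]
    rw [this, h]
  simp [trace_fin_two, Matrix.mul_apply, Fin.sum_univ_two, vecMul, dotProduct] at t1 t2 t3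
  have hbd' : (b : ℂ) - d ≠ 0 := by
    rw [sub_ne_zero]; exact_mod_cast hbd
  have h00 : η 0 0 = 0 := by
    have : ((b : ℂ) - d) * η 0 0 = 0 := by linear_combination t2 - (d : ℂ) * t1
    exact (mul_eq_zero.1 this).resolve_left hbd'
  have h11 : η 1 1 = 0 := by linear_combination t1 - h00
  rw [← l2_mul_unitary hV, ← e1, ← e2, hl, h00, h11]
  simp [h00, h11] at t3 ⊢
  right
  linarith

/-! ### Infinitesimal rotations -/

/-- A traceless skew-Hermitian matrix squares to a nonpositive scalar. -/
theorem mul_self_of_skew {Z : Mat} (hZ : Zᴴ = -Z) (htr : Z.trace = 0) :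
    ∃ k : ℝ, 0 ≤ k ∧ Z * Z = -((k : ℂ) • 1) := by
  refine ⟨‖Z 0 0‖ ^ 2 + ‖Z 0 1‖ ^ 2, by positivity, ?_⟩
  have e00 := congrFun (congrFun hZ 0) 0
  have e01 := congrFun (congrFun hZ 1) 0
  simp [conjTranspose_apply] at e00 e01
  rw [trace_fin_two] at htr
  have e11 : Z 1 1 = -Z 0 0 := by linear_combination htr
  have e10 : Z 1 0 = -star (Z 0 1) := by rw [RCLike.star_def, e01, neg_neg]
  have n0 := Complex.conj_mul' (Z 0 0)
  have n1 := Complex.conj_mul' (Z 0 1)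
  rw [e00] at n0
  push_cast
  rw [← n0, ← n1]
  ext i j
  fin_cases i <;> fin_cases j <;>
    simp [Matrix.mul_apply, Fin.sum_univ_two, e11, e10] <;> ring

/-- `1 + r Z` is a multiple of a unitary matrix, and its inverse is a multiple of `1 - r Z`. These
matrices replace the exponential of `r Z` as a family of rotations with velocity `Z`. -/
theorem one_add_smul_conformal {Z : Mat} (hZ : Zᴴ = -Z) {k : ℝ} (hk : Z * Z = -((k : ℂ) • 1))
    (r : ℝ) :
    (1 + (r : ℂ) • Z)ᴴ * (1 + (r : ℂ) • Z) = ((1 + r ^ 2 * k : ℝ) : ℂ) • 1 ∧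
    (1 + (r : ℂ) • Z) * (1 - (r : ℂ) • Z) = ((1 + r ^ 2 * k : ℝ) : ℂ) • 1 ∧
    (1 - (r : ℂ) • Z) * (1 + (r : ℂ) • Z) = ((1 + r ^ 2 * k : ℝ) : ℂ) • 1 := by
  have h1 : (1 + (r : ℂ) • Z)ᴴ = 1 - (r : ℂ) • Z := by
    simp [conjTranspose_add, conjTranspose_smul, hZ, sub_eq_add_neg]
  have h2 : (1 + (r : ℂ) • Z) * (1 - (r : ℂ) • Z) = ((1 + r ^ 2 * k : ℝ) : ℂ) • 1 := by
    have : (1 + (r : ℂ) • Z) * (1 - (r : ℂ) • Z) = 1 - ((r : ℂ) * r) • (Z * Z) := by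
      rw [add_mul, mul_sub, mul_sub, one_mul, mul_one, smul_mul_smul_comm, one_mul]; abel
    rw [this, hk]
    push_cast
    rw [add_smul, smul_neg, smul_smul, one_smul, sub_neg_eq_add, pow_two]
  have h3 : (1 - (r : ℂ) • Z) * (1 + (r : ℂ) • Z) = ((1 + r ^ 2 * k : ℝ) : ℂ) • 1 := by
    rw [← h2, add_mul, sub_mul, mul_sub, mul_add, mul_sub, mul_add, one_mul, one_mul, mul_one]
    abel
  exact ⟨h1 ▸ h3, h2, h3⟩

theorem hasDerivAt_rational (k c₀ c₁ c₂ : ℝ) :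
    HasDerivAt (fun r : ℝ => (1 + r ^ 2 * k)⁻¹ * ((1 + r ^ 2 * k)⁻¹ *
      (c₀ - 2 * r * c₁ + r ^ 2 * c₂))) (-2 * c₁) 0 := by
  have h1 : HasDerivAt (fun r : ℝ => 1 + r ^ 2 * k) 0 0 := by
    simpa using ((hasDerivAt_pow 2 (0 : ℝ)).mul_const k).const_add 1
  have h2 : HasDerivAt (fun r : ℝ => c₀ - 2 * r * c₁ + r ^ 2 * c₂) (-2 * c₁) 0 := by
    have := ((((hasDerivAt_id (0 : ℝ)).const_mul 2).mul_const c₁).const_sub c₀).add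
      ((hasDerivAt_pow 2 (0 : ℝ)).mul_const c₂)
    simpa using! this
  have h3 := h1.inv (by simp)
  have := h3.mul (h3.mul h2)
  simpa using! this

theorem l2_sub_smul_self {A : Mat} (hA : A.det ≠ 0) (X Y : Mat) (r : ℝ) :
    l2 A (X - (r : ℂ) • Y) (X - (r : ℂ) • Y) =
      l2 A X X - 2 * r * l2 A Y X + r ^ 2 * l2 A Y Y := by
  rw [l2_sub_right hA, l2_smul_right, l2_symm A (X - _) X, l2_symm A (X - _) Y, l2_sub_right hA,
    l2_sub_right hA, l2_smul_right, l2_smul_right, l2_symm A X Y]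
  ring

/-- The derivative of the metric along an infinitesimal rotation of the target sphere. -/
theorem hasDerivAt_l2_skew_mul {A Z : Mat} (hA : A.det ≠ 0) (hZ : Zᴴ = -Z) (htr : Z.trace = 0)
    (X : Mat) :
    HasDerivAt (fun r : ℝ => l2 (A + r • (Z * A)) X X) (-2 * l2 A (Z * X) X) 0 := by
  obtain ⟨k, hk0, hk⟩ := mul_self_of_skew hZ htr
  refine (hasDerivAt_rational k (l2 A X X) (l2 A (Z * X) X)
    (l2 A (Z * X) (Z * X))).congr_of_eventuallyEq (Eventually.of_forall fun r => ?_)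
  obtain ⟨h1, h2, h3⟩ := one_add_smul_conformal hZ hk r
  have hs : 0 < 1 + r ^ 2 * k := by positivity
  set s := 1 + r ^ 2 * k
  have hs' : (s : ℂ) ≠ 0 := by exact_mod_cast hs.ne'
  have e1 : A + r • (Z * A) = (1 + (r : ℂ) • Z) * A := by
    rw [add_mul, one_mul, smul_mul_assoc, Complex.coe_smul]
  have e2 : X = (1 + (r : ℂ) • Z) * (((s⁻¹ : ℝ) : ℂ) • (X - (r : ℂ) • (Z * X))) := by
    have : X - (r : ℂ) • (Z * X) = (1 - (r : ℂ) • Z) * X := by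
      rw [sub_mul, one_mul, smul_mul_assoc]
    rw [this, mul_smul_comm, ← mul_assoc, h2, smul_mul_assoc, one_mul, smul_smul]
    push_cast
    rw [inv_mul_cancel₀ hs', one_smul]
  simp only
  have h := l2_mul_left hs h1 A (((s⁻¹ : ℝ) : ℂ) • (X - (r : ℂ) • (Z * X)))
    (((s⁻¹ : ℝ) : ℂ) • (X - (r : ℂ) • (Z * X)))
  rw [← e1, ← e2] at h
  rw [h, l2_smul_left, l2_smul_right, l2_sub_smul_self hA]

/-- The derivative of the metric along an infinitesimal rotation of the domain sphere. -/
theorem hasDerivAt_l2_mul_skew {A Z : Mat} (hA : A.det ≠ 0) (hZ : Zᴴ = -Z) (htr : Z.trace = 0)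
    (X : Mat) :
    HasDerivAt (fun r : ℝ => l2 (A + r • (A * Z)) X X) (-2 * l2 A (X * Z) X) 0 := by
  obtain ⟨k, hk0, hk⟩ := mul_self_of_skew hZ htr
  refine (hasDerivAt_rational k (l2 A X X) (l2 A (X * Z) X)
    (l2 A (X * Z) (X * Z))).congr_of_eventuallyEq (Eventually.of_forall fun r => ?_)
  obtain ⟨h1, h2, h3⟩ := one_add_smul_conformal hZ hk r
  have hs : 0 < 1 + r ^ 2 * k := by positivity
  set s := 1 + r ^ 2 * k
  have hs' : (s : ℂ) ≠ 0 := by exact_mod_cast hs.ne'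
  have e1 : A + r • (A * Z) = A * (1 + (r : ℂ) • Z) := by
    rw [mul_add, mul_one, mul_smul_comm, Complex.coe_smul]
  have e2 : X = (((s⁻¹ : ℝ) : ℂ) • (X - (r : ℂ) • (X * Z))) * (1 + (r : ℂ) • Z) := by
    have : X - (r : ℂ) • (X * Z) = X * (1 - (r : ℂ) • Z) := by
      rw [mul_sub, mul_one, mul_smul_comm]
    rw [this, smul_mul_assoc, mul_assoc, h3, mul_smul_comm, mul_one, smul_smul]
    push_cast
    rw [inv_mul_cancel₀ hs', one_smul]
  simp only
  have h := l2_mul_right hs h1 A (((s⁻¹ : ℝ) : ℂ) • (X - (r : ℂ) • (X * Z)))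
    (((s⁻¹ : ℝ) : ℂ) • (X - (r : ℂ) • (X * Z)))
  rw [← e1, ← e2] at h
  rw [h, l2_smul_left, l2_smul_right, l2_sub_smul_self hA]

/-! ### Derivatives along curves of matrices -/

/-- Entrywise derivative of a curve of matrices, which needs no choice of a matrix norm. -/
def HasMatDerivAt (Y : ℝ → Mat) (Y' : Mat) (t : ℝ) : Prop :=
  ∀ i j, HasDerivAt (fun s => Y s i j) (Y' i j) t

namespace HasMatDerivAt

variable {Y W : ℝ → Mat} {Y' W' : Mat} {t : ℝ}

theorem const (C : Mat) (t : ℝ) : HasMatDerivAt (fun _ => C) 0 t := fun _ _ => hasDerivAt_const _ _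

theorem sub (hY : HasMatDerivAt Y Y' t) (hW : HasMatDerivAt W W' t) :
    HasMatDerivAt (fun s => Y s - W s) (Y' - W') t := fun i j => (hY i j).sub (hW i j)

theorem mul (hY : HasMatDerivAt Y Y' t) (hW : HasMatDerivAt W W' t) :
    HasMatDerivAt (fun s => Y s * W s) (Y' * W t + Y t * W') t := by
  intro i j
  have h := ((hY i 0).mul (hW 0 j)).add ((hY i 1).mul (hW 1 j))
  simp only [Matrix.add_apply, Matrix.mul_apply, Fin.sum_univ_two]
  exact h.congr_deriv (by ring)

theorem smul {c : ℝ → ℂ} {c' : ℂ} (hc : HasDerivAt c c' t) (hY : HasMatDerivAt Y Y' t) :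
    HasMatDerivAt (fun s => c s • Y s) (c' • Y t + c t • Y') t := fun i j => hc.mul (hY i j)

theorem conjTranspose (hY : HasMatDerivAt Y Y' t) :
    HasMatDerivAt (fun s => (Y s)ᴴ) Y'ᴴ t := fun i j => (hY j i).star

theorem trace (hY : HasMatDerivAt Y Y' t) : HasDerivAt (fun s => (Y s).trace) Y'.trace t := by
  simp only [trace_fin_two]
  exact (hY 0 0).add (hY 1 1)

end HasMatDerivAt

/-- The metric in terms of its values on the real basis of matrix units. -/
theorem l2_expand {A : Mat} (hA : A.det ≠ 0) (X Y : Mat) :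
    l2 A X Y = ∑ i, ∑ j, ((Y i j).re * l2 A X (single i j 1) +
      (Y i j).im * l2 A X (single i j Complex.I)) := by
  have h : Y = ∑ i, ∑ j, ((((Y i j).re : ℝ) : ℂ) • single i j (1 : ℂ) +
      (((Y i j).im : ℝ) : ℂ) • single i j Complex.I) := by
    conv_lhs => rw [matrix_eq_sum_single Y]
    refine Finset.sum_congr rfl fun i _ => Finset.sum_congr rfl fun j _ => ?_
    rw [smul_single, smul_single, ← single_add]
    congr 1
    simp
  conv_lhs => rw [h]
  simp only [Fin.sum_univ_two, l2_add_right hA, l2_smul_right]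

theorem hasDerivAt_re {f : ℝ → ℂ} {f' : ℂ} {t : ℝ} (h : HasDerivAt f f' t) :
    HasDerivAt (fun s => (f s).re) f'.re t := by
  have := Complex.reCLM.hasFDerivAt.comp_hasDerivAt t h
  exact this

theorem hasDerivAt_im {f : ℝ → ℂ} {f' : ℂ} {t : ℝ} (h : HasDerivAt f f' t) :
    HasDerivAt (fun s => (f s).im) f'.im t := by
  have := Complex.imCLM.hasFDerivAt.comp_hasDerivAt t h
  exact this

theorem hasDerivAt_l2_right {A : Mat} (hA : A.det ≠ 0) (X : Mat) {Y : ℝ → Mat} {Y' : Mat} {t : ℝ}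
    (hY : HasMatDerivAt Y Y' t) : HasDerivAt (fun s => l2 A X (Y s)) (l2 A X Y') t := by
  simp only [fun s => l2_expand hA X (Y s), l2_expand hA X Y', Fin.sum_univ_two]
  have h : ∀ i j, HasDerivAt (fun s => (Y s i j).re * l2 A X (single i j 1) +
      (Y s i j).im * l2 A X (single i j Complex.I))
      ((Y' i j).re * l2 A X (single i j 1) + (Y' i j).im * l2 A X (single i j Complex.I)) t :=
    fun i j => ((hasDerivAt_re (hY i j)).mul_const _).add ((hasDerivAt_im (hY i j)).mul_const _)
  exact ((h 0 0).add (h 0 1)).add ((h 1 0).add (h 1 1))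

/-- If the momentum `l2 (a s) (v s)` is differentiable on constant vectors, then it is
differentiable on moving vectors, by the product rule. -/
theorem hasDerivAt_l2_curve {a v : ℝ → Mat} {L : Mat → ℝ} {t : ℝ}
    (hdet : ∀ᶠ s in 𝓝 t, (a s).det ≠ 0)
    (hL : ∀ Y, HasDerivAt (fun s => l2 (a s) (v s) Y) (L Y) t)
    {Y : ℝ → Mat} {Y' : Mat} (hY : HasMatDerivAt Y Y' t) :
    HasDerivAt (fun s => l2 (a s) (v s) (Y s)) (L (Y t) + l2 (a t) (v t) Y') t := by
  have hdett := hdet.self_of_nhds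
  have h : ∀ i j, HasDerivAt (fun s => ((Y s - Y t) i j).re * l2 (a s) (v s) (single i j 1) +
      ((Y s - Y t) i j).im * l2 (a s) (v s) (single i j Complex.I))
      ((Y' i j).re * l2 (a t) (v t) (single i j 1) +
        (Y' i j).im * l2 (a t) (v t) (single i j Complex.I)) t := by
    intro i j
    have hs : HasDerivAt (fun s => (Y s - Y t) i j) (Y' i j) t := (hY i j).sub_const _
    have := ((hasDerivAt_re hs).mul (hL (single i j 1))).add
      ((hasDerivAt_im hs).mul (hL (single i j Complex.I)))
    refine this.congr_deriv ?_
    simp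
  have hsum := (hL (Y t)).add (((h 0 0).add (h 0 1)).add ((h 1 0).add (h 1 1)))
  rw [l2_expand hdett (v t) Y']
  simp only [Fin.sum_univ_two]
  refine hsum.congr_of_eventuallyEq ?_
  filter_upwards [hdet] with s hs
  have e : l2 (a s) (v s) (Y s) = l2 (a s) (v s) (Y t) + l2 (a s) (v s) (Y s - Y t) := by
    rw [l2_sub_right hs]; ring
  rw [e, l2_expand hs (v s) (Y s - Y t)]
  simp only [Fin.sum_univ_two]
  rfl

/-! ### Conservation of the momenta -/

/-- The curve `a` with velocity `v` conserves, near time zero, the momenta of the rotations of the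
target sphere and of the domain sphere. -/
def ConservesMomenta (a v : ℝ → Mat) : Prop :=
  ∀ᶠ t in 𝓝 (0 : ℝ), HasMatDerivAt a (v t) t ∧ (a t).det ≠ 0 ∧
    ∀ Z : Mat, Zᴴ = -Z → Z.trace = 0 →
      l2 (a t) (v t) (Z * a t) = l2 (a 0) (v 0) (Z * a 0) ∧
      l2 (a t) (v t) (a t * Z) = l2 (a 0) (v 0) (a 0 * Z)

/-- Noether's theorem for the geodesic equation in its variational form. -/
theorem conservesMomenta_of_geodesic {a v : ℝ → Mat} {ε : ℝ} (hε : 0 < ε)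
    (hd : ∀ t ∈ Ioo (-ε) ε, HasMatDerivAt a (v t) t)
    (hdet : ∀ t ∈ Ioo (-ε) ε, (a t).det ≠ 0)
    (hgeo : ∀ t ∈ Ioo (-ε) ε, ∀ Y : Mat, HasDerivAt (fun s => l2 (a s) (v s) Y)
      (1 / 2 * deriv (fun r : ℝ => l2 (a t + r • Y) (v t) (v t)) 0) t) :
    ConservesMomenta a v := by
  have h0 : (0 : ℝ) ∈ Ioo (-ε) ε := ⟨by linarith, hε⟩
  have hnear : ∀ t ∈ Ioo (-ε) ε, Ioo (-ε) ε ∈ 𝓝 t := fun t ht => isOpen_Ioo.mem_nhds ht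
  have hdet' : ∀ t ∈ Ioo (-ε) ε, ∀ᶠ s in 𝓝 t, (a s).det ≠ 0 := fun t ht => by
    filter_upwards [hnear t ht] with s hs using hdet s hs
  have hconst : ∀ f : ℝ → ℝ, (∀ t ∈ Ioo (-ε) ε, HasDerivAt f 0 t) →
      ∀ t ∈ Ioo (-ε) ε, f t = f 0 := fun f hf t ht =>
    isOpen_Ioo.is_const_of_deriv_eq_zero isPreconnected_Ioo
      (fun s hs => (hf s hs).differentiableAt.differentiableWithinAt)
      (fun s hs => (hf s hs).deriv) ht h0
  filter_upwards [hnear 0 h0] with t ht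
  refine ⟨hd t ht, hdet t ht, fun Z hZ htr => ⟨?_, ?_⟩⟩
  · refine hconst (fun s => l2 (a s) (v s) (Z * a s)) (fun t ht => ?_) t ht
    have h := hasDerivAt_l2_curve (hdet' t ht) (hgeo t ht)
      ((HasMatDerivAt.const Z t).mul (hd t ht))
    refine h.congr_deriv ?_
    rw [(hasDerivAt_l2_skew_mul (hdet t ht) hZ htr (v t)).deriv, zero_mul, zero_add,
      l2_symm (a t) (v t)]
    ring
  · refine hconst (fun s => l2 (a s) (v s) (a s * Z)) (fun t ht => ?_) t ht
    have h := hasDerivAt_l2_curve (hdet' t ht) (hgeo t ht)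
      ((hd t ht).mul (HasMatDerivAt.const Z t))
    refine h.congr_deriv ?_
    rw [(hasDerivAt_l2_mul_skew (hdet t ht) hZ htr (v t)).deriv, mul_zero, add_zero,
      l2_symm (a t) (v t)]
    ring

/-- Conservation of the momenta does not depend on the choice of the coefficient curve. -/
theorem ConservesMomenta.gauge {a v : ℝ → Mat} (h : ConservesMomenta a v) {c d : ℂ} (hc : c ≠ 0) :
    ConservesMomenta (fun t => (c + t * d) • a t) (fun t => (c + t * d) • v t + d • a t) := by
  have hf : ∀ t : ℝ, HasDerivAt (fun t : ℝ => c + t * d) d t := by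
    intro t
    simpa using! (((hasDerivAt_id t).ofReal_comp).mul_const d).const_add c
  have hne : ∀ᶠ t : ℝ in 𝓝 0, c + t * d ≠ 0 :=
    (hf 0).continuousAt.eventually_ne (by simpa using hc)
  have hl : ∀ (A X Y : Mat) (e : ℂ), e ≠ 0 → l2 (e • A) (e • X + d • A) (e • Y) = l2 A X Y := by
    intro A X Y e he
    have h0 : l2 (e • A) (e • X + d • A) (e • Y + (0 : ℂ) • A) = l2 A X Y :=
      gam_descends A X Y e d 0 he
    rwa [zero_smul, add_zero] at h0
  filter_upwards [h, hne] with t ⟨h1, h2, h3⟩ ht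
  refine ⟨?_, ?_, fun Z hZ htr => ⟨?_, ?_⟩⟩
  · rw [add_comm]
    exact HasMatDerivAt.smul (hf t) h1
  · rw [det_smul]
    exact mul_ne_zero (pow_ne_zero _ ht) h2
  · simp only [mul_smul_comm]
    rw [hl _ _ _ _ ht, hl _ _ _ _ (by simpa using hc), (h3 Z hZ htr).1]
  · simp only [smul_mul_assoc]
    rw [hl _ _ _ _ ht, hl _ _ _ _ (by simpa using hc), (h3 Z hZ htr).2]

/-! ### Curves with `𝛌` in a plane -/

/-- The derivative of `Aᴴ A` in the direction `X`. -/
def gramVel (A X : Mat) : Mat := Xᴴ * A + Aᴴ * X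

/-- The derivative along a curve through `A` with velocity `X` of the vector
`Z A - A W`, where `Z = 2 A [N, H] Aᴴ` and `W = tr H • [N, H]` with `H = Aᴴ A`; the two factors
`A` outside `Z` and `W` are held fixed. -/
def planeDefect (N A X : Mat) : Mat :=
  (2 : ℂ) • (X * (N * (Aᴴ * A) - Aᴴ * A * N) * Aᴴ + A * (N * gramVel A X - gramVel A X * N) * Aᴴ +
      A * (N * (Aᴴ * A) - Aᴴ * A * N) * Xᴴ) * A -
    A * ((gramVel A X).trace • (N * (Aᴴ * A) - Aᴴ * A * N) +
      (Aᴴ * A).trace • (N * gramVel A X - gramVel A X * N))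

theorem star_trace_of_isHermitian {H : Mat} (hH : Hᴴ = H) : star H.trace = H.trace := by
  rw [← trace_conjTranspose, hH]

theorem trace_mul_eq_zero {N H : Mat} (hN : Nᴴ = N) (hH : Hᴴ = H) (h : (N * H).trace.re = 0) :
    (N * H).trace = 0 := by
  have h1 : star (N * H).trace = (N * H).trace := by
    rw [← trace_conjTranspose, conjTranspose_mul, hN, hH, trace_mul_comm]
  have h2 : (N * H).trace.im = 0 := Complex.conj_eq_iff_im.1 h1
  exact Complex.ext h h2

/-- If `N = n · τ` and `H` has vector part `h` orthogonal to `n`, then `[N, H] = 2 i (n × h) · τ` and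
both sides are `4 |h|² n · τ`, by `(n × h) × h = -|h|² n`. -/
theorem two_smul_commutator_mul {N H : Mat} (htr : N.trace = 0) (hNH : (N * H).trace = 0) :
    (2 : ℂ) • ((N * H - H * N) * H) - H.trace • (N * H - H * N) =
      (H.trace ^ 2 - 4 * H.det) • N := by
  -- `N` anticommutes with the traceless part of `H`.
  have f1 : H * N = H.trace • N - N * H := by
    rw [trace_fin_two] at htr
    simp [trace_fin_two, Matrix.mul_apply, Fin.sum_univ_two] at hNH
    have e : N 1 1 = -N 0 0 := by linear_combination htr
    rw [e] at hNH
    ext i j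
    fin_cases i <;> fin_cases j <;>
      simp [trace_fin_two, Matrix.mul_apply, Fin.sum_univ_two, e]
    · linear_combination hNH
    · ring
    · ring
    · linear_combination hNH
  -- The Cayley-Hamilton theorem.
  have f2 : H * H = H.trace • H - H.det • 1 := by
    ext i j
    fin_cases i <;> fin_cases j <;>
      simp [trace_fin_two, Matrix.mul_apply, Fin.sum_univ_two, det_fin_two] <;> ring
  have f3 : (N * H - H * N) * H = (2 : ℂ) • (H.trace • (N * H) - H.det • N) - H.trace • (N * H) := by
    rw [f1, sub_mul, sub_mul, smul_mul_assoc, mul_assoc, f2, mul_sub, mul_smul_comm, mul_smul_comm,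
      mul_one]
    module
  rw [f3, f1]
  module

theorem trace_real_mul {r : ℂ} (hr : star r = r) (M : Mat) (h : M.trace.re = 0) :
    (r • M).trace.re = 0 := by
  have : r.im = 0 := Complex.conj_eq_iff_im.1 hr
  rw [trace_smul, smul_eq_mul, Complex.mul_re, h, this]; ring

theorem commutator_skew {N H : Mat} (hN : Nᴴ = N) (hH : Hᴴ = H) :
    (N * H - H * N)ᴴ = -(N * H - H * N) := by
  rw [conjTranspose_sub, conjTranspose_mul, conjTranspose_mul, hN, hH, neg_sub]

/-- If `𝛌` and its velocity are orthogonal to the vector of `N`, then `X` is orthogonal to the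
combination `Z A - A W` of infinitesimal rotations with `Z = 2 A [N, H] Aᴴ` and `W = tr H • [N, H]`,
which is a real multiple of `A N`. -/
theorem l2_combination_eq_zero {A X N : Mat} (hdet : A.det ≠ 0) (hN : Nᴴ = N) (htr : N.trace = 0)
    (hp : (N * (Aᴴ * A)).trace.re = 0) (hv : (N * gramVel A X).trace.re = 0) :
    l2 A X ((2 : ℂ) • (A * (N * (Aᴴ * A) - Aᴴ * A * N) * Aᴴ) * A -
      A * ((Aᴴ * A).trace • (N * (Aᴴ * A) - Aᴴ * A * N))) = 0 := by
  have hH : (Aᴴ * A)ᴴ = Aᴴ * A := by simp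
  have e : ∀ C : Mat, (2 : ℂ) • (A * C * Aᴴ) * A = A * ((2 : ℂ) • (C * (Aᴴ * A))) := fun C => by
    rw [smul_mul_assoc, mul_smul_comm, mul_assoc _ Aᴴ A, mul_assoc]
  have hNH := trace_mul_eq_zero hN hH hp
  rw [e, ← mul_sub, two_smul_commutator_mul htr hNH]
  by_cases hs : ∃ c : ℂ, Aᴴ * A = c • 1
  · obtain ⟨c, hc⟩ := hs
    have h0 : (Aᴴ * A).trace ^ 2 - 4 * (Aᴴ * A).det = 0 := by
      rw [hc, trace_smul, det_smul, trace_one, det_one]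
      simp
      ring
    rw [h0, zero_smul, mul_zero, l2_zero_right]
  · push Not at hs
    refine l2_eq_zero_of_trace hdet hs (by simp [htr]) ?_ ?_
    · rw [mul_smul_comm, trace_smul, trace_mul_comm (Aᴴ * A) N, hNH, smul_zero]
    · have hreal : star ((Aᴴ * A).trace ^ 2 - 4 * (Aᴴ * A).det) =
          (Aᴴ * A).trace ^ 2 - 4 * (Aᴴ * A).det := by
        have : star (Aᴴ * A).det = (Aᴴ * A).det := by rw [← det_conjTranspose, hH]
        simp only [star_sub, star_pow, star_mul', star_trace_of_isHermitian hH, this]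
        simp
      rw [conjTranspose_smul, hreal, hN, smul_mul_assoc, smul_mul_assoc]
      refine trace_real_mul hreal _ ?_
      have h1 : (N * (Xᴴ * A)).trace = star (N * Aᴴ * X).trace := by
        rw [← trace_conjTranspose, conjTranspose_mul, conjTranspose_mul, hN,
          conjTranspose_conjTranspose, trace_mul_comm, mul_assoc]
      rw [gramVel, mul_add, trace_add, h1, ← mul_assoc] at hv
      simp at hv
      linarith

/-- If a curve conserves the momenta of the rotations and `𝛌` stays in the plane orthogonal to the
vector of `N`, then the derivative of a combination of the momenta that vanishes identically
gives a condition on the initial velocity. -/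
theorem ConservesMomenta.l2_planeDefect_eq_zero {a v : ℝ → Mat} (h : ConservesMomenta a v)
    {N : Mat} (hN : Nᴴ = N) (htr : N.trace = 0)
    (hplane : ∀ᶠ t in 𝓝 0, (N * ((a t)ᴴ * a t)).trace.re = 0) :
    (N * gramVel (a 0) (v 0)).trace.re = 0 ∧
      l2 (a 0) (v 0) (planeDefect N (a 0) (v 0)) = 0 := by
  have hgram : ∀ᶠ t in 𝓝 0, HasMatDerivAt (fun s => (a s)ᴴ * a s) (gramVel (a t) (v t)) t := by
    filter_upwards [h] with t ht
    exact ht.1.conjTranspose.mul ht.1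
  have hvel : ∀ᶠ t in 𝓝 0, (N * gramVel (a t) (v t)).trace.re = 0 := by
    filter_upwards [hgram, hplane.eventually_nhds] with t ht hp
    have h1 := hasDerivAt_re ((HasMatDerivAt.const N t).mul ht).trace
    have h2 : HasDerivAt (fun s => (N * ((a s)ᴴ * a s)).trace.re) 0 t :=
      (hasDerivAt_const t (0 : ℝ)).congr_of_eventuallyEq hp
    have h3 := h1.unique h2
    simpa using h3
  refine ⟨hvel.self_of_nhds, ?_⟩
  -- By conservation, the combination of momenta is a function of `a t` and the initial data only.
  have hzero : ∀ᶠ t in 𝓝 0, l2 (a 0) (v 0)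
      ((2 : ℂ) • (a t * (N * ((a t)ᴴ * a t) - (a t)ᴴ * a t * N) * (a t)ᴴ) * a 0 -
        a 0 * (((a t)ᴴ * a t).trace • (N * ((a t)ᴴ * a t) - (a t)ᴴ * a t * N))) = 0 := by
    filter_upwards [h, hplane, hvel] with t ⟨_, hdet, hc⟩ hp hv
    have hcomb := l2_combination_eq_zero hdet hN htr hp hv
    have hH : ((a t)ᴴ * a t)ᴴ = (a t)ᴴ * a t := by simp
    have htrace : (a t * (N * ((a t)ᴴ * a t) - (a t)ᴴ * a t * N) * (a t)ᴴ).trace = 0 := by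
      rw [mul_assoc, trace_mul_comm, mul_assoc, sub_mul, trace_sub, sub_eq_zero,
        trace_mul_comm (N * _), ← mul_assoc]
    generalize (a t)ᴴ * a t = H at *
    have hskew := commutator_skew hN hH
    have hZ : ((2 : ℂ) • (a t * (N * H - H * N) * (a t)ᴴ))ᴴ =
        -((2 : ℂ) • (a t * (N * H - H * N) * (a t)ᴴ)) := by
      rw [conjTranspose_smul, conjTranspose_mul, conjTranspose_mul, hskew,
        conjTranspose_conjTranspose, ← mul_assoc, mul_neg, neg_mul, smul_neg]
      simp
    have hZt : ((2 : ℂ) • (a t * (N * H - H * N) * (a t)ᴴ)).trace = 0 := by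
      rw [trace_smul, htrace, smul_zero]
    have hW : (H.trace • (N * H - H * N))ᴴ = -(H.trace • (N * H - H * N)) := by
      rw [conjTranspose_smul, star_trace_of_isHermitian hH, hskew, smul_neg]
    have hWt : (H.trace • (N * H - H * N)).trace = 0 := by
      rw [trace_smul, trace_sub, trace_mul_comm, sub_self, smul_zero]
    rw [l2_sub_right h.self_of_nhds.2.1, ← (hc _ hZ hZt).1, ← (hc _ hW hWt).2,
      ← l2_sub_right hdet, hcomb]
  have h0 := h.self_of_nhds
  have hg0 := hgram.self_of_nhds
  have hN0 := HasMatDerivAt.const N 0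
  have hcomm := (hN0.mul hg0).sub (hg0.mul hN0)
  have hZ' := (((h0.1.mul hcomm).mul h0.1.conjTranspose).smul
    (hasDerivAt_const (0 : ℝ) (2 : ℂ))).mul (HasMatDerivAt.const (a 0) 0)
  have hW' := (HasMatDerivAt.const (a 0) 0).mul (HasMatDerivAt.smul hg0.trace hcomm)
  have hder := hasDerivAt_l2_right h0.2.1 (v 0) (hZ'.sub hW')
  have hder0 : HasDerivAt (fun s => l2 (a 0) (v 0)
      ((2 : ℂ) • (a s * (N * ((a s)ᴴ * a s) - (a s)ᴴ * a s * N) * (a s)ᴴ) * a 0 -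
        a 0 * (((a s)ᴴ * a s).trace • (N * ((a s)ᴴ * a s) - (a s)ᴴ * a s * N)))) 0 0 :=
    (hasDerivAt_const (0 : ℝ) (0 : ℝ)).congr_of_eventuallyEq hzero
  refine Eq.trans ?_ (hder.unique hder0)
  refine congrArg (l2 (a 0) (v 0)) ?_
  unfold planeDefect
  simp only [zero_mul, mul_zero, zero_smul, zero_add, add_zero, add_mul]

/-! ### Normals to planes -/

/-- The traceless Hermitian matrix `n · τ`. -/
def pauliDot (n : E₃) : Mat :=
  !![(n 2 : ℂ), n 0 - Complex.I * n 1; n 0 + Complex.I * n 1, -(n 2 : ℂ)]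

theorem conjTranspose_pauliDot (n : E₃) : (pauliDot n)ᴴ = pauliDot n := by
  ext i j
  fin_cases i <;> fin_cases j <;> simp [pauliDot, conjTranspose_apply]
  ring

theorem trace_pauliDot (n : E₃) : (pauliDot n).trace = 0 := by
  simp [pauliDot, trace_fin_two]

/-- The matrix `-i [H, K]`, which is `2 (h × k) · τ` for Hermitian matrices with traceless parts
`h · τ` and `k · τ`. -/
def normalMat (H K : Mat) : Mat := (-Complex.I) • (H * K - K * H)

/-- A Hermitian matrix in real coordinates. -/
theorem exists_coords_of_isHermitian {H : Mat} (hH : Hᴴ = H) :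
    ∃ x y p q : ℝ, H = !![(p : ℂ), x - Complex.I * y; x + Complex.I * y, (q : ℂ)] := by
  have e00 := congrFun (congrFun hH 0) 0
  have e10 := congrFun (congrFun hH 1) 0
  have e11 := congrFun (congrFun hH 1) 1
  rw [conjTranspose_apply] at e00 e10 e11
  refine ⟨(H 0 1).re, -(H 0 1).im, (H 0 0).re, (H 1 1).re, ?_⟩
  have i00 : (H 0 0).im = 0 := Complex.conj_eq_iff_im.1 e00
  have i11 : (H 1 1).im = 0 := Complex.conj_eq_iff_im.1 e11
  ext i j
  fin_cases i <;> fin_cases j <;> apply Complex.ext <;> simp [i00, i11, ← e10]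

/-- A vector orthogonal to `h` and `k` is parallel to `h × k`. -/
theorem normalMat_eq_smul_pauliDot {H K : Mat} (hH : Hᴴ = H) (hK : Kᴴ = K) {n : E₃} (hn : n ≠ 0)
    (h1 : (pauliDot n * H).trace.re = 0) (h2 : (pauliDot n * K).trace.re = 0) :
    ∃ r : ℝ, normalMat H K = (r : ℂ) • pauliDot n := by
  obtain ⟨x, y, p, q, rfl⟩ := exists_coords_of_isHermitian hH
  obtain ⟨x', y', p', q', rfl⟩ := exists_coords_of_isHermitian hK
  have hnn : n 0 ^ 2 + n 1 ^ 2 + n 2 ^ 2 ≠ 0 := by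
    rw [← norm_sq_E₃]; exact pow_ne_zero _ (norm_ne_zero_iff.2 hn)
  simp [pauliDot, trace_fin_two] at h1 h2
  obtain ⟨w0, hw0⟩ : ∃ w, w = y * (p' - q') - (p - q) * y' := ⟨_, rfl⟩
  obtain ⟨w1, hw1⟩ : ∃ w, w = (p - q) * x' - x * (p' - q') := ⟨_, rfl⟩
  obtain ⟨w2, hw2⟩ : ∃ w, w = 2 * (x * y' - y * x') := ⟨_, rfl⟩
  have hN : normalMat !![(p : ℂ), x - Complex.I * y; x + Complex.I * y, (q : ℂ)]
      !![(p' : ℂ), x' - Complex.I * y'; x' + Complex.I * y', (q' : ℂ)] =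
      !![(w2 : ℂ), w0 - Complex.I * w1; w0 + Complex.I * w1, -(w2 : ℂ)] := by
    ext i j
    fin_cases i <;> fin_cases j <;> apply Complex.ext <;>
      simp [normalMat, hw0, hw1, hw2] <;> ring
  set r := (n 0 * w0 + n 1 * w1 + n 2 * w2) / (n 0 ^ 2 + n 1 ^ 2 + n 2 ^ 2) with hr
  have hr' : r * (n 0 ^ 2 + n 1 ^ 2 + n 2 ^ 2) = n 0 * w0 + n 1 * w1 + n 2 * w2 := by
    rw [hr]; field_simp
  have g0 : w0 = r * n 0 := by
    apply mul_left_cancel₀ hnn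
    rw [mul_comm, mul_comm _ (r * n 0), mul_right_comm, hr', hw0, hw1, hw2]
    linear_combination (n 1 * ((p' - q') / 2) - n 2 * y') * h1 -
      (n 1 * ((p - q) / 2) - n 2 * y) * h2
  have g1 : w1 = r * n 1 := by
    apply mul_left_cancel₀ hnn
    rw [mul_comm, mul_comm _ (r * n 1), mul_right_comm, hr', hw0, hw1, hw2]
    linear_combination (n 2 * x' - n 0 * ((p' - q') / 2)) * h1 -
      (n 2 * x - n 0 * ((p - q) / 2)) * h2
  have g2 : w2 = r * n 2 := by
    apply mul_left_cancel₀ hnn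
    rw [mul_comm, mul_comm _ (r * n 2), mul_right_comm, hr', hw0, hw1, hw2]
    linear_combination (n 0 * y' - n 1 * x') * h1 -
      (n 0 * y - n 1 * x) * h2
  refine ⟨r, ?_⟩
  rw [hN, g0, g1, g2]
  ext i j
  fin_cases i <;> fin_cases j <;> simp [pauliDot] <;> ring

/-! ### The cubic criterion -/

/-- The normal `-i [Aᴴ A, d(Aᴴ A)(X)]` to the plane through the origin containing `𝛌` and its
velocity. -/
def planeNormal (A X : Mat) : Mat := normalMat (Aᴴ * A) (gramVel A X)

/-- The criterion on an initial velocity `X` at `A`, a cubic form in `X`: if it does not vanish,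
then `𝛌` leaves every plane through the origin. -/
def criterion (A X : Mat) : ℝ := l2 A X (planeDefect (planeNormal A X) A X)

theorem gramVel_isHermitian (A X : Mat) : (gramVel A X)ᴴ = gramVel A X := by
  simp [gramVel, conjTranspose_add, conjTranspose_mul, add_comm]

theorem gramVel_add (A X Y : Mat) : gramVel A (X + Y) = gramVel A X + gramVel A Y := by
  simp only [gramVel, conjTranspose_add, add_mul, mul_add]; abel

theorem gramVel_smul (A X : Mat) (t : ℝ) : gramVel A ((t : ℂ) • X) = (t : ℂ) • gramVel A X := by
  simp [gramVel, conjTranspose_smul]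

theorem planeNormal_add (A X Y : Mat) :
    planeNormal A (X + Y) = planeNormal A X + planeNormal A Y := by
  simp only [planeNormal, normalMat, gramVel_add, mul_add, add_mul]; module

theorem planeNormal_smul (A X : Mat) (t : ℝ) :
    planeNormal A ((t : ℂ) • X) = (t : ℂ) • planeNormal A X := by
  simp only [planeNormal, normalMat, gramVel_smul, mul_smul_comm, smul_mul_assoc]; module

theorem planeDefect_add_left (N M A X : Mat) :
    planeDefect (N + M) A X = planeDefect N A X + planeDefect M A X := by
  simp only [planeDefect, mul_add, add_mul, mul_sub, sub_mul, smul_mul_assoc, mul_smul_comm]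
  module

theorem planeDefect_smul_left (c : ℂ) (N A X : Mat) :
    planeDefect (c • N) A X = c • planeDefect N A X := by
  simp only [planeDefect, mul_add, add_mul, mul_sub, sub_mul, smul_mul_assoc, mul_smul_comm]
  module

theorem planeDefect_add_right (N A X Y : Mat) :
    planeDefect N A (X + Y) = planeDefect N A X + planeDefect N A Y := by
  simp only [planeDefect, gramVel_add, conjTranspose_add, trace_add, mul_add, add_mul, mul_sub,
    sub_mul, smul_mul_assoc, mul_smul_comm]
  module

theorem planeDefect_smul_right (t : ℝ) (N A X : Mat) :
    planeDefect N A ((t : ℂ) • X) = (t : ℂ) • planeDefect N A X := by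
  simp only [planeDefect, gramVel_smul, conjTranspose_smul, RCLike.star_def, Complex.conj_ofReal,
    trace_smul, smul_eq_mul, mul_add, add_mul, mul_sub,
    sub_mul, smul_mul_assoc, mul_smul_comm]
  module

/-- Along a line, the criterion is a cubic polynomial. -/
theorem exists_criterion_add_smul {A : Mat} (hA : A.det ≠ 0) (X X₀ : Mat) :
    ∃ c₀ c₁ c₂ : ℝ, ∀ t : ℝ, criterion A (X + (t : ℂ) • X₀) =
      c₀ + c₁ * t + c₂ * t ^ 2 + criterion A X₀ * t ^ 3 := by
  set Y₀ := planeDefect (planeNormal A X) A X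
  set Y₁ := planeDefect (planeNormal A X) A X₀ + planeDefect (planeNormal A X₀) A X
  set Y₂ := planeDefect (planeNormal A X₀) A X₀ with hY₂
  refine ⟨l2 A X Y₀, l2 A X₀ Y₀ + l2 A X Y₁, l2 A X₀ Y₁ + l2 A X Y₂, fun t => ?_⟩
  have e : planeDefect (planeNormal A (X + (t : ℂ) • X₀)) A (X + (t : ℂ) • X₀) =
      Y₀ + ((t : ℂ) • Y₁ + (t : ℂ) • (t : ℂ) • Y₂) := by
    simp only [planeNormal_add, planeNormal_smul, planeDefect_add_left, planeDefect_smul_left,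
      planeDefect_add_right, planeDefect_smul_right, Y₀, Y₁, Y₂]
    module
  simp only [criterion, e, l2_add_left hA, l2_add_right hA, l2_smul_left, l2_smul_right, ← hY₂]
  ring

/-- The criterion vanishes on an initial velocity for which `𝛌` stays in some plane through the
origin. -/
theorem criterion_eq_zero_of_plane {a v : ℝ → Mat} (h : ConservesMomenta a v) {n : E₃}
    (hn : n ≠ 0) (hplane : ∀ᶠ t in 𝓝 0, (pauliDot n * ((a t)ᴴ * a t)).trace.re = 0) :
    criterion (a 0) (v 0) = 0 := by
  obtain ⟨h1, h2⟩ := h.l2_planeDefect_eq_zero (conjTranspose_pauliDot n) (trace_pauliDot n) hplane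
  obtain ⟨r, hr⟩ := normalMat_eq_smul_pauliDot (by simp) (gramVel_isHermitian (a 0) (v 0)) hn
    hplane.self_of_nhds h1
  rw [criterion, planeNormal, hr, planeDefect_smul_left, l2_smul_right, h2, mul_zero]

/-- The criterion is invariant under rotations of the domain. -/
theorem criterion_mul_unitary {V : Mat} (hV : Vᴴ * V = 1) (A X : Mat) :
    criterion (A * V) (X * V) = criterion A X := by
  have hV' : V * Vᴴ = 1 := mul_eq_one_comm.1 hV
  have c : ∀ M : Mat, V * (Vᴴ * M) = M := fun M => by rw [← mul_assoc, hV', one_mul]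
  have e1 : gramVel (A * V) (X * V) = Vᴴ * gramVel A X * V := by
    simp only [gramVel, conjTranspose_mul, mul_add, add_mul, mul_assoc]
  have e2 : (A * V)ᴴ * (A * V) = Vᴴ * (Aᴴ * A) * V := by
    simp only [conjTranspose_mul, mul_assoc]
  have e3 : planeNormal (A * V) (X * V) = Vᴴ * planeNormal A X * V := by
    simp only [planeNormal, normalMat, e1, e2, mul_smul_comm, smul_mul_assoc, mul_sub, sub_mul,
      mul_assoc, c]
  have ht : ∀ M : Mat, (Vᴴ * (M * V)).trace = M.trace := fun M => by
    rw [trace_mul_comm, mul_assoc, hV', mul_one]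
  have ht' : (Vᴴ * (Aᴴ * (A * V))).trace = (Aᴴ * A).trace := by rw [← mul_assoc Aᴴ, ht]
  have e4 : planeDefect (planeNormal (A * V) (X * V)) (A * V) (X * V) =
      planeDefect (planeNormal A X) A X * V := by
    simp only [planeDefect, e1, e3, conjTranspose_mul, mul_assoc, ht, ht', c, mul_sub, sub_mul,
      mul_add, add_mul, smul_mul_assoc, mul_smul_comm]
  rw [criterion, e4, l2_mul_unitary hV, criterion]

/-- The criterion is a nonzero cubic form at every map with `𝛌 ≠ 0`. -/
theorem exists_criterion_ne_zero {A : Mat} (hA : A.det ≠ 0) (hns : ∀ c : ℂ, Aᴴ * A ≠ c • 1) :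
    ∃ X, criterion A X ≠ 0 := by
  obtain ⟨V, b, d, hb, hd, hV, hdet, hdiag, hscal⟩ := exists_diagonalization hA
  have hbd : b ≠ d := fun h => hns b (hscal h)
  obtain ⟨J, I₁, hJ, hl⟩ := exists_l2_of_diagonal hdiag hb hd hdet
  obtain ⟨B, hB⟩ : ∃ B, B = A * V := ⟨_, rfl⟩
  rw [← hB] at hdet hdiag hl
  -- With `H = diag(b, d)`, the diagonal of `ξ` moves `𝛌` along itself, the entries `i` rotate the
  -- domain and thereby tilt `𝛌`, and `d, -b` rotate the target and leave `𝛌` fixed. The criterion at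
  -- this velocity is `4 J (b - d)⁴ b d`.
  set ξ : Mat := !![1, d + Complex.I; -b + Complex.I, -1] with hξ
  refine ⟨B * ξ * Vᴴ, ?_⟩
  rw [← criterion_mul_unitary hV, mul_assoc _ Vᴴ V, hV, mul_one, ← hB]
  set H : Mat := !![(b : ℂ), 0; 0, (d : ℂ)] with hH
  set K : Mat := !![2 * (b : ℂ), Complex.I * (b - d); -(Complex.I * (b - d)), -(2 * (d : ℂ))] with hK
  set C : Mat := ((b : ℂ) - d) ^ 3 • !![0, -1; 1, 0] with hC
  set C' : Mat := (2 * ((b : ℂ) - d) ^ 2) •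
    !![-(Complex.I * (b - d)), -(b + d : ℂ); b + d, Complex.I * (b - d)] with hC'
  have eK : gramVel B (B * ξ) = K := by
    have : gramVel B (B * ξ) = ξᴴ * H + H * ξ := by
      rw [gramVel, conjTranspose_mul, ← hdiag]; noncomm_ring
    rw [this]
    ext i j
    fin_cases i <;> fin_cases j <;> apply Complex.ext <;>
      simp [hξ, hH, hK, Matrix.mul_apply, Fin.sum_univ_two] <;> ring
  have eN : planeNormal B (B * ξ) = ((b : ℂ) - d) ^ 2 • !![0, 1; 1, 0] := by
    rw [planeNormal, hdiag, eK, normalMat]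
    have hI := Complex.I_sq
    ext i j
    fin_cases i <;> fin_cases j <;>
      simp [hH, hK]
    · ring
    · linear_combination (-((b : ℂ) - d) ^ 2) * hI
    · linear_combination (-((b : ℂ) - d) ^ 2) * hI
    · ring
  set N := planeNormal B (B * ξ) with hN
  have eC : N * H - H * N = C := by
    rw [eN]
    ext i j
    fin_cases i <;> fin_cases j <;>
      simp [hH, hC] <;> ring
  have eC' : N * K - K * N = C' := by
    rw [eN]
    ext i j
    fin_cases i <;> fin_cases j <;>
      simp [hK, hC'] <;> ring
  set η : Mat := (2 : ℂ) • (ξ * C * H + C' * H + C * ξᴴ * H) - (K.trace • C + H.trace • C') with hη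
  have eη : planeDefect N B (B * ξ) = B * η := by
    rw [planeDefect, eK, hdiag, eC, eC', conjTranspose_mul B ξ, hη]
    simp only [mul_add, add_mul, mul_sub, smul_mul_assoc, mul_smul_comm, mul_assoc, hdiag]
  have hξ' : ξᴴ = !![1, -b - Complex.I; d - Complex.I, -1] := by
    ext i j
    fin_cases i <;> fin_cases j <;> simp [hξ, conjTranspose_apply] <;> ring
  have eη' : η = !![(((b - d) ^ 3 * (2 * (b + d)) : ℝ) : ℂ) * Complex.I,
      (((b - d) ^ 3 * (4 * b) : ℝ) : ℂ); (((b - d) ^ 3 * (4 * d) : ℝ) : ℂ),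
      -((((b - d) ^ 3 * (2 * (b + d)) : ℝ) : ℂ) * Complex.I)] := by
    rw [hη, hξ', hξ]
    ext i j
    fin_cases i <;> fin_cases j <;>
      simp [hC, hC', hH, hK, trace_fin_two] <;> ring
  rw [criterion, ← hN, eη, hl, eη']
  have v : J * (b * (ξ 0 1 * star (((b - d) ^ 3 * (4 * b) : ℝ) : ℂ)).re +
      d * (ξ 1 0 * star (((b - d) ^ 3 * (4 * d) : ℝ) : ℂ)).re) +
      I₁ * ((ξ 0 0 - ξ 1 1) * star ((((b - d) ^ 3 * (2 * (b + d)) : ℝ) : ℂ) * Complex.I -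
        -((((b - d) ^ 3 * (2 * (b + d)) : ℝ) : ℂ) * Complex.I))).re =
      4 * J * (b - d) ^ 4 * b * d := by
    generalize (b - d) ^ 3 * (2 * (b + d)) = p
    obtain ⟨q, hq⟩ : ∃ q, q = (b - d) ^ 3 * (4 * b) := ⟨_, rfl⟩
    obtain ⟨q', hq'⟩ : ∃ q, q = (b - d) ^ 3 * (4 * d) := ⟨_, rfl⟩
    rw [← hq, ← hq']
    simp [hξ]
    rw [hq, hq']
    ring
  refine ne_of_eq_of_ne v ?_
  have : b - d ≠ 0 := sub_ne_zero.2 hbd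
  positivity

/-! ### The polar decomposition and the position -/

theorem exists_smul_of_mk_eq {g g' : GL (Fin 2) ℂ}
    (h : Matrix.ProjGenLinGroup.mk g = Matrix.ProjGenLinGroup.mk g') :
    ∃ u : ℂ, u ≠ 0 ∧ (g' : Mat) = u • (g : Mat) := by
  obtain ⟨u, hu⟩ := Matrix.ProjGenLinGroup.mk_eq_mk_iff.1 h
  refine ⟨u, u.ne_zero, ?_⟩
  rw [← hu]
  ext i j
  simp [mul_comm]

theorem conjTranspose_smul_mul_smul (u : ℂ) (M : Mat) :
    (u • M)ᴴ * (u • M) = ((‖u‖ ^ 2 : ℝ) : ℂ) • (Mᴴ * M) := by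
  rw [conjTranspose_smul, smul_mul_assoc, mul_smul_comm, smul_smul]
  congr 1
  have := Complex.conj_mul' u
  simpa using! this

/-- `gᴴ g` is a positive multiple of the square of the boost. -/
theorem exists_gram_eq (g : GL (Fin 2) ℂ) : ∃ s : ℝ, 0 < s ∧
    (g : Mat)ᴴ * (g : Mat) = (s : ℂ) •
      (boost (lam (Matrix.ProjGenLinGroup.mk g)) * boost (lam (Matrix.ProjGenLinGroup.mk g))) := by
  obtain ⟨U, hU, g', hg', hx⟩ := (isPolar_iff (Matrix.ProjGenLinGroup.mk g) _).2 rfl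
  obtain ⟨u, hu, he⟩ := exists_smul_of_mk_eq hx
  refine ⟨‖u‖ ^ 2, by positivity, ?_⟩
  have hU' : Uᴴ * U = 1 := by
    rw [← star_eq_conjTranspose]; exact mem_unitaryGroup_iff'.1 hU
  rw [he, conjTranspose_smul_mul_smul, hg', conjTranspose_mul, boost_conjTranspose, mul_assoc,
    ← mul_assoc Uᴴ, hU', one_mul]

theorem inner_E₃ (m n : E₃) : inner ℝ m n = m 0 * n 0 + m 1 * n 1 + m 2 * n 2 := by
  simp [PiLp.inner_apply, Fin.sum_univ_three, mul_comm]

theorem trace_pauliDot_mul_boost_sq (n l : E₃) :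
    (pauliDot n * (boost l * boost l)).trace.re = 4 * √(1 + ‖l‖ ^ 2) * inner ℝ n l := by
  rw [boost_sq, inner_E₃]
  simp [pauliDot, trace_fin_two, -Complex.ofReal_pow]
  ring

/-- The vector part of `gᴴ g` is a positive multiple of `𝛌`. -/
theorem exists_trace_pauliDot_mul_gram (g : GL (Fin 2) ℂ) : ∃ s : ℝ, 0 < s ∧ ∀ n : E₃,
    (pauliDot n * ((g : Mat)ᴴ * (g : Mat))).trace.re =
      s * inner ℝ n (lam (Matrix.ProjGenLinGroup.mk g)) := by
  obtain ⟨s, hs, h⟩ := exists_gram_eq g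
  refine ⟨s * (4 * √(1 + ‖lam (Matrix.ProjGenLinGroup.mk g)‖ ^ 2)), by positivity, fun n => ?_⟩
  rw [h, mul_smul_comm, trace_smul, smul_eq_mul, Complex.re_ofReal_mul,
    trace_pauliDot_mul_boost_sq]
  ring

theorem gram_ne_scalar {g : GL (Fin 2) ℂ} (hl : lam (Matrix.ProjGenLinGroup.mk g) ≠ 0) (c : ℂ) :
    (g : Mat)ᴴ * (g : Mat) ≠ c • 1 := by
  intro h
  obtain ⟨s, hs, hn⟩ := exists_trace_pauliDot_mul_gram g
  have h1 := hn (lam (Matrix.ProjGenLinGroup.mk g))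
  rw [h, mul_smul_comm, mul_one, trace_smul, trace_pauliDot, smul_zero, Complex.zero_re,
    real_inner_self_eq_norm_sq] at h1
  have : 0 < ‖lam (Matrix.ProjGenLinGroup.mk g)‖ := norm_pos_iff.2 hl
  have h2 : 0 < s * ‖lam (Matrix.ProjGenLinGroup.mk g)‖ ^ 2 := by positivity
  exact h2.ne h1

theorem spherePoint_coords (v : Fin 2 → ℂ) :
    spherePoint v 0 = 2 * ((v 0).re * (v 1).re + (v 0).im * (v 1).im) / nsq v ∧
    spherePoint v 1 = 2 * ((v 0).re * (v 1).im - (v 0).im * (v 1).re) / nsq v ∧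
    spherePoint v 2 =
      ((v 0).re ^ 2 + (v 0).im ^ 2 - (v 1).re ^ 2 - (v 1).im ^ 2) / nsq v := by
  refine ⟨?_, ?_, ?_⟩ <;>
    simp [spherePoint, pauli, dotProduct, mulVec, Fin.sum_univ_two] <;> congr 1 <;> ring

theorem nsq_eq (v : Fin 2 → ℂ) :
    nsq v = (v 0).re ^ 2 + (v 0).im ^ 2 + ((v 1).re ^ 2 + (v 1).im ^ 2) := by
  rw [nsq, ← Complex.normSq_eq_norm_sq, ← Complex.normSq_eq_norm_sq, Complex.normSq_apply,
    Complex.normSq_apply]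
  ring

theorem norm_spherePoint {v : Fin 2 → ℂ} (hv : v ≠ 0) : ‖spherePoint v‖ = 1 := by
  have hn := (nsq_pos hv).ne'
  obtain ⟨h0, h1, h2⟩ := spherePoint_coords v
  have : ‖spherePoint v‖ ^ 2 = 1 := by
    rw [norm_sq_E₃, h0, h1, h2, div_pow, div_pow, div_pow, ← add_div, ← add_div,
      div_eq_one_iff_eq (pow_ne_zero _ hn), nsq_eq]
    ring
  exact (pow_eq_one_iff_of_nonneg (norm_nonneg _) two_ne_zero).1 this

theorem exists_spherePoint_eq {u : E₃} (hu : ‖u‖ = 1) : ∃ w, w ≠ 0 ∧ spherePoint w = u := by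
  have hs : u 0 ^ 2 + u 1 ^ 2 + u 2 ^ 2 = 1 := by rw [← norm_sq_E₃, hu]; norm_num
  by_cases h : u 2 = -1
  · have h0 : u 0 = 0 := by rw [h] at hs; nlinarith [sq_nonneg (u 0), sq_nonneg (u 1)]
    have h1 : u 1 = 0 := by rw [h] at hs; nlinarith [sq_nonneg (u 0), sq_nonneg (u 1)]
    refine ⟨![0, 1], fun h => by simpa using congrFun h 1, ?_⟩
    obtain ⟨c0, c1, c2⟩ := spherePoint_coords ![0, 1]
    ext i
    fin_cases i
    · exact c0.trans (by simp [h0])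
    · exact c1.trans (by simp [h1])
    · exact c2.trans (by simp [h, nsq])
  · have hne : 1 + u 2 ≠ 0 := fun h' => h (by linarith)
    set w : Fin 2 → ℂ := ![1 + u 2, u 0 + Complex.I * u 1] with hw
    have hn : nsq w = 2 * (1 + u 2) := by
      rw [nsq_eq]; simp [hw]; linarith
    refine ⟨w, fun h => hne ?_, ?_⟩
    · have := congrArg Complex.re (congrFun h 0)
      simpa [hw] using this
    · obtain ⟨c0, c1, c2⟩ := spherePoint_coords w
      rw [hn] at c0 c1 c2
      ext i
      fin_cases i
      · refine c0.trans ?_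
        rw [div_eq_iff (by positivity)]; simp [hw]; ring
      · refine c1.trans ?_
        rw [div_eq_iff (by positivity)]; simp [hw]; ring
      · refine c2.trans ?_
        rw [div_eq_iff (by positivity)]; simp [hw]; linarith

theorem nsq_boost_mulVec (l : E₃) {v : Fin 2 → ℂ} (hv : v ≠ 0) :
    nsq (boost l *ᵥ v) =
      nsq v * (1 + 2 * ‖l‖ ^ 2 + 2 * √(1 + ‖l‖ ^ 2) * inner ℝ l (spherePoint v)) := by
  have hn := (nsq_pos hv).ne'
  have hs : √(1 + ‖l‖ ^ 2) ^ 2 = 1 + (l 0 ^ 2 + l 1 ^ 2 + l 2 ^ 2) := by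
    rw [Real.sq_sqrt (by positivity), norm_sq_E₃]
  obtain ⟨h0, h1, h2⟩ := spherePoint_coords v
  rw [inner_E₃, h0, h1, h2]
  have : nsq v * (1 + 2 * ‖l‖ ^ 2 + 2 * √(1 + ‖l‖ ^ 2) *
      (l 0 * (2 * ((v 0).re * (v 1).re + (v 0).im * (v 1).im) / nsq v) +
        l 1 * (2 * ((v 0).re * (v 1).im - (v 0).im * (v 1).re) / nsq v) +
        l 2 * (((v 0).re ^ 2 + (v 0).im ^ 2 - (v 1).re ^ 2 - (v 1).im ^ 2) / nsq v))) =
      nsq v * (1 + 2 * ‖l‖ ^ 2) + 2 * √(1 + ‖l‖ ^ 2) *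
      (l 0 * (2 * ((v 0).re * (v 1).re + (v 0).im * (v 1).im)) +
        l 1 * (2 * ((v 0).re * (v 1).im - (v 0).im * (v 1).re)) +
        l 2 * (((v 0).re ^ 2 + (v 0).im ^ 2 - (v 1).re ^ 2 - (v 1).im ^ 2))) := by
    field_simp
  rw [this, nsq_eq, nsq_eq, boost_eq, norm_sq_E₃]
  rw [norm_sq_E₃] at hs
  simp [mulVec, dotProduct, Fin.sum_univ_two, -Complex.ofReal_pow]
  generalize √(1 + (l 0 ^ 2 + l 1 ^ 2 + l 2 ^ 2)) = r at hs
  linear_combination ((v 0).re ^ 2 + (v 0).im ^ 2 + (v 1).re ^ 2 + (v 1).im ^ 2) * hs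

theorem nsq_mulVec_eq_of_gram {M B : Mat} {s : ℝ} (h : Mᴴ * M = (s : ℂ) • (Bᴴ * B))
    (v : Fin 2 → ℂ) : nsq (M *ᵥ v) = s * nsq (B *ᵥ v) := by
  have : ((nsq (M *ᵥ v) : ℝ) : ℂ) = ((s * nsq (B *ᵥ v) : ℝ) : ℂ) := by
    push_cast
    rw [ofReal_nsq, ofReal_nsq, star_mulVec, dotProduct_mulVec, vecMul_vecMul, h, star_mulVec,
      dotProduct_mulVec (star v ᵥ* Bᴴ), vecMul_vecMul, vecMul_smul, smul_dotProduct, smul_eq_mul]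
  exact_mod_cast this

/-- The position of a lump with `𝛌 ≠ 0` is `-𝛌 / λ`. -/
theorem eq_of_isLumpPosition {x : M₁} {p : E₃} (hp : IsLumpPosition x p) (hl : lam x ≠ 0) :
    p = -(‖lam x‖⁻¹ • lam x) := by
  obtain ⟨g, rfl, v, hv, rfl, hmax⟩ := hp
  set l := lam (Matrix.ProjGenLinGroup.mk g) with hldef
  obtain ⟨s, hs, hg⟩ := exists_gram_eq g
  rw [← hldef] at hg
  have hlpos : 0 < ‖l‖ := norm_pos_iff.2 hl
  have hdet : (g : Mat).det ≠ 0 := (Matrix.isUnit_iff_isUnit_det _).1 g.isUnit |>.ne_zero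
  set r := √(1 + ‖l‖ ^ 2) with hr
  have hrpos : 0 < r := Real.sqrt_pos.2 (by positivity)
  have hnsq : ∀ w : Fin 2 → ℂ, w ≠ 0 → nsq ((g : Mat) *ᵥ w) =
      nsq w * (s * (1 + 2 * ‖l‖ ^ 2 + 2 * r * inner ℝ l (spherePoint w))) := by
    intro w hw
    rw [nsq_mulVec_eq_of_gram (B := boost l) (by rw [hg, boost_conjTranspose]),
      nsq_boost_mulVec l hw]
    ring
  obtain ⟨w, hw, hwl⟩ := exists_spherePoint_eq (u := -(‖l‖⁻¹ • l))
    (by rw [norm_neg, norm_smul, norm_inv, norm_norm, inv_mul_cancel₀ hlpos.ne'])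
  have he := hmax w hw
  have hpv := nsq_mulVec_pos hdet hv
  have hpw := nsq_mulVec_pos hdet hw
  have hnv := nsq_pos hv
  have hnw := nsq_pos hw
  rw [hnsq v hv] at hpv
  rw [hnsq w hw] at hpw
  unfold energyDensity at he
  rw [hnsq v hv, hnsq w hw] at he
  have qv := pos_of_mul_pos_right hpv hnv.le
  have qw := pos_of_mul_pos_right hpw hnw.le
  set ev := s * (1 + 2 * ‖l‖ ^ 2 + 2 * r * inner ℝ l (spherePoint v)) with hev
  set ew := s * (1 + 2 * ‖l‖ ^ 2 + 2 * r * inner ℝ l (spherePoint w)) with hew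
  have hle : ev ≤ ew := by
    have hcancel : ∀ n e : ℝ, 0 < n → 0 < e →
        ‖(g : Mat).det‖ ^ 2 * n ^ 2 / (n * e) ^ 2 = ‖(g : Mat).det‖ ^ 2 / e ^ 2 := by
      intro n e hn he
      field_simp
    rw [hcancel _ _ hnw qw, hcancel _ _ hnv qv] at he
    by_contra! hlt
    have : ‖(g : Mat).det‖ ^ 2 / ev ^ 2 < ‖(g : Mat).det‖ ^ 2 / ew ^ 2 := by
      gcongr
    linarith
  have hil : inner ℝ l (spherePoint v) ≤ inner ℝ l (spherePoint w) := by
    have : 0 < 2 * r * s := by positivity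
    nlinarith
  rw [hwl, inner_neg_right, inner_smul_right, real_inner_self_eq_norm_sq] at hil
  have h1 : ‖l‖⁻¹ * ‖l‖ ^ 2 = ‖l‖ := by field_simp
  rw [h1] at hil
  have hzero : ‖spherePoint v + ‖l‖⁻¹ • l‖ ^ 2 ≤ 0 := by
    rw [norm_add_sq_real, norm_spherePoint hv, norm_smul, norm_inv, norm_norm,
      inv_mul_cancel₀ hlpos.ne', inner_smul_right, real_inner_comm]
    have h2 : ‖l‖⁻¹ * inner ℝ l (spherePoint v) ≤ ‖l‖⁻¹ * (-‖l‖) := by gcongr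
    rw [mul_neg, inv_mul_cancel₀ hlpos.ne'] at h2
    linarith
  have h3 : ‖spherePoint v + ‖l‖⁻¹ • l‖ = 0 := by nlinarith [sq_nonneg ‖spherePoint v + ‖l‖⁻¹ • l‖]
  exact eq_neg_of_add_eq_zero_left (norm_eq_zero.1 h3)

/-! ### Null sets -/

instance : (volume : Measure Coeff).IsAddHaarMeasure :=
  haveI (_ : Fin 2) : (volume : Measure (Fin 2 → ℂ)).IsAddHaarMeasure := inferInstance
  Measure.pi.isAddHaarMeasure (fun _ : Fin 2 => (volume : Measure (Fin 2 → ℂ)))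

instance : (volume : Measure (Coeff × Coeff)).IsOpenPosMeasure :=
  inferInstanceAs ((volume : Measure Coeff).prod (volume : Measure Coeff)).IsOpenPosMeasure

/-- A closed condition that on each line in one direction is the vanishing of a nonzero polynomial
holds almost nowhere. -/
theorem volume_eq_zero_of_polynomial_on_lines {f : Coeff → ℝ}
    (hf : MeasurableSet {X | f X = 0}) (X₀ : Coeff)
    (h : ∀ X, ∃ p : Polynomial ℝ, p ≠ 0 ∧ ∀ t : ℝ, f (X + t • X₀) = p.eval t) :
    volume {X | f X = 0} = 0 := by
  have key := ae_mem_of_ae_add_linearMap_mem (LinearMap.toSpanSingleton ℝ Coeff X₀) volume volume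
    (s := {X | f X = 0}ᶜ) hf.compl ?_
  · rw [ae_iff] at key
    simpa using key
  · intro X
    obtain ⟨p, hp, hpe⟩ := h X
    rw [ae_iff]
    refine measure_mono_null (t := p.rootSet ℝ) ?_ ((p.rootSet_finite ℝ).measure_zero _)
    intro t ht
    simp only [mem_compl_iff, not_not, mem_ofPred_eq, LinearMap.toSpanSingleton_apply] at ht
    rw [Polynomial.mem_rootSet_of_ne hp, Polynomial.coe_aeval_eq_eval, ← hpe t]
    exact ht

theorem continuousAt_criterion (q : Mat × Mat) (h : q.1.det ≠ 0) :
    ContinuousAt (fun q : Mat × Mat => criterion q.1 q.2) q := by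
  have hg : Continuous fun q : Mat × Mat => gramVel q.1 q.2 := by
    unfold gramVel; fun_prop
  have hN : Continuous fun q : Mat × Mat => planeNormal q.1 q.2 := by
    unfold planeNormal normalMat; fun_prop
  have hP : Continuous fun q : Mat × Mat => planeDefect (planeNormal q.1 q.2) q.1 q.2 := by
    unfold planeDefect
    have h1 := hg.matrix_trace
    have h2 : Continuous fun q : Mat × Mat => (q.1ᴴ * q.1).trace :=
      Continuous.matrix_trace (by fun_prop)
    fun_prop
  exact (continuousAt_l2 (q.1, q.2, _) h).comp
    (f := fun q : Mat × Mat => (q.1, q.2, planeDefect (planeNormal q.1 q.2) q.1 q.2))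
    (by fun_prop)

theorem isOpen_det_ne_zero : IsOpen {q : Coeff × Coeff | (of q.1).det ≠ 0} :=
  isOpen_ne_fun (Continuous.matrix_det (A := fun q : Coeff × Coeff => of q.1) continuous_fst)
    continuous_const

theorem isOpen_criterion_ne_zero :
    IsOpen {q : Coeff × Coeff | (of q.1).det ≠ 0 ∧ criterion q.1 q.2 ≠ 0} := by
  have h : ContinuousOn (fun q : Coeff × Coeff => criterion q.1 q.2)
      {q : Coeff × Coeff | (of q.1).det ≠ 0} :=
    fun q hq => (continuousAt_criterion q hq).continuousWithinAt
  exact h.isOpen_inter_preimage isOpen_det_ne_zero isOpen_compl_singleton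

/-- The criterion holds for almost every velocity at a map with `𝛌 ≠ 0`. -/
theorem volume_criterion_eq_zero {A : Coeff} (hA : (of A).det ≠ 0)
    (hns : ∀ c : ℂ, (of A)ᴴ * of A ≠ c • 1) : volume {X : Coeff | criterion A X = 0} = 0 := by
  obtain ⟨X₀, hX₀⟩ := exists_criterion_ne_zero hA hns
  have hcont : Continuous fun X : Coeff => criterion A X := by
    rw [continuous_iff_continuousAt]
    intro X
    exact (continuousAt_criterion (A, X) hA).comp (f := fun X : Coeff => ((A, X) : Mat × Mat))
      (by fun_prop)
  refine volume_eq_zero_of_polynomial_on_lines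
    (isClosed_eq hcont continuous_const).measurableSet X₀ fun X => ?_
  obtain ⟨c₀, c₁, c₂, hc⟩ := exists_criterion_add_smul hA X X₀
  refine ⟨Polynomial.C c₀ + Polynomial.C c₁ * Polynomial.X + Polynomial.C c₂ * Polynomial.X ^ 2 +
    Polynomial.C (criterion (of A) X₀) * Polynomial.X ^ 3, fun h => hX₀ ?_, fun t => ?_⟩
  · have := congrArg (fun p => Polynomial.coeff p 3) h
    simpa [Polynomial.coeff_X, Polynomial.coeff_C] using this
  · have e' : (of X + (t : ℂ) • X₀ : Mat) = of X + t • X₀ := by rw [Complex.coe_smul]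
    have := hc t
    refine (congrArg (criterion (of A)) e').symm.trans (this.trans ?_)
    simp

/-- `𝛌` vanishes almost nowhere: the columns of a matrix with `Aᴴ A` scalar have equal length. -/
theorem volume_scalar_gram :
    volume {A : Coeff | ∃ c : ℂ, (of A)ᴴ * of A = c • 1} = 0 := by
  let f : Coeff → ℝ := fun A => ‖A 0 0‖ ^ 2 + ‖A 1 0‖ ^ 2 - ‖A 0 1‖ ^ 2 - ‖A 1 1‖ ^ 2
  have hf : Continuous f := by fun_prop
  refine measure_mono_null (t := {A | f A = 0}) ?_ ?_
  · rintro A ⟨c, hc⟩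
    have h0 := congrFun (congrFun hc 0) 0
    have h1 := congrFun (congrFun hc 1) 1
    simp [Matrix.mul_apply, Fin.sum_univ_two, Complex.conj_mul'] at h0 h1
    have h : ((f A : ℝ) : ℂ) = 0 := by
      simp only [f]
      push_cast
      linear_combination h0 - h1
    exact_mod_cast h
  -- Along the direction of the first entry, `f` is a monic quadratic polynomial.
  · refine volume_eq_zero_of_polynomial_on_lines (isClosed_eq hf continuous_const).measurableSet
      (fun i j => if i = 0 ∧ j = 0 then 1 else 0) fun A => ?_
    refine ⟨Polynomial.C (f A) + Polynomial.C (2 * (A 0 0).re) * Polynomial.X + Polynomial.X ^ 2,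
      fun h => ?_, fun t => ?_⟩
    · have := congrArg (fun p => Polynomial.coeff p 2) h
      simp at this
    · simp [f, ← Complex.normSq_eq_norm_sq, Complex.normSq_apply]
      ring

/-! ### The set of initial velocities -/

/-- The initial velocities with a representative at which the criterion does not vanish. -/
def goodVelocities : Set TM₁ :=
  {ξ | ∃ q : TCoord, Quotient.mk tangentSetoid q = ξ ∧ criterion q.1.1 q.1.2 ≠ 0}

theorem isOpen_goodVelocities : IsOpen goodVelocities := by
  have : (Quotient.mk tangentSetoid : TCoord → TM₁) ⁻¹' goodVelocities =
      ⋃ c : ℂ, ⋃ d : ℂ, {p : TCoord | c ≠ 0} ∩ (fun p : TCoord =>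
        ((c • p.1.1, c • p.1.2 + d • p.1.1) : Coeff × Coeff)) ⁻¹'
        {q : Coeff × Coeff | (of q.1).det ≠ 0 ∧ criterion q.1 q.2 ≠ 0} := by
    ext p
    simp only [mem_iUnion, mem_inter_iff, mem_preimage]
    constructor
    · rintro ⟨q, hqp, hq⟩
      obtain ⟨c, d, hc, h1, h2⟩ := Quotient.exact hqp.symm
      refine ⟨c, d, hc, ?_⟩
      rw [← h1, ← h2]
      exact ⟨q.2, hq⟩
    · rintro ⟨c, d, hc, hdet, hcrit⟩
      exact ⟨⟨_, hdet⟩, Quotient.sound (Setoid.symm ⟨c, d, hc, rfl, rfl⟩), hcrit⟩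
  change IsOpen ((Quotient.mk tangentSetoid : TCoord → TM₁) ⁻¹' goodVelocities)
  rw [this]
  refine isOpen_iUnion fun c => isOpen_iUnion fun d => isOpen_const.inter ?_
  exact isOpen_criterion_ne_zero.preimage (by fun_prop)

theorem criterion_eq_zero_of_notMem {a X : Coeff} {h : (of a).det ≠ 0}
    (hξ : tangent a X h ∈ goodVelocitiesᶜ) : criterion a X = 0 := by
  by_contra hc
  exact hξ ⟨⟨(a, X), h⟩, rfl, hc⟩

theorem nullInTM₁_compl_goodVelocities : NullInTM₁ goodVelocitiesᶜ := by
  have hm : MeasurableSet {q : Coeff × Coeff | (of q.1).det ≠ 0 ∧ criterion q.1 q.2 = 0} := by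
    have : {q : Coeff × Coeff | (of q.1).det ≠ 0 ∧ criterion q.1 q.2 = 0} =
        {q : Coeff × Coeff | (of q.1).det ≠ 0} \
          {q : Coeff × Coeff | (of q.1).det ≠ 0 ∧ criterion q.1 q.2 ≠ 0} := by
      ext q
      simp only [mem_ofPred_eq, Set.mem_sdiff]
      tauto
    rw [this]
    exact isOpen_det_ne_zero.measurableSet.diff isOpen_criterion_ne_zero.measurableSet
  refine measure_mono_null
    (t := {q : Coeff × Coeff | (of q.1).det ≠ 0 ∧ criterion q.1 q.2 = 0}) ?_ ?_
  · rintro q ⟨h, hq⟩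
    exact ⟨h, criterion_eq_zero_of_notMem hq⟩
  · refine (Measure.measure_prod_null hm).2 ?_
    have hae : ∀ᵐ A : Coeff, ¬ ∃ c : ℂ, (of A)ᴴ * of A = c • 1 := by
      rw [ae_iff]; simpa using volume_scalar_gram
    filter_upwards [hae] with A hA
    by_cases hdet : (of A).det = 0
    · simp [hdet]
    · push Not at hA
      refine measure_mono_null (fun X hX => ?_) (volume_criterion_eq_zero hdet hA)
      exact hX.2

theorem nullInFibre_compl_goodVelocities (a : Coeff) (h : (of a).det ≠ 0)
    (hl : lam (toM₁ a h) ≠ 0) : NullInFibre a h goodVelocitiesᶜ :=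
  measure_mono_null (fun _ hX => criterion_eq_zero_of_notMem hX)
    (volume_criterion_eq_zero h (gram_ne_scalar (g := toGL a h) hl))

/-- The complement of a null set is dense, as a nonempty open set of the tangent bundle has positive
measure. -/
theorem dense_of_nullInTM₁_compl {G : Set TM₁} (hG : NullInTM₁ Gᶜ) : Dense G := by
  rw [dense_iff_inter_open]
  intro O hO hne
  by_contra hemp
  rw [not_nonempty_iff_eq_empty] at hemp
  have hcont : Continuous (Quotient.mk tangentSetoid : TCoord → TM₁) := continuous_quotient_mk'
  have hopen : IsOpen (Subtype.val '' ((Quotient.mk tangentSetoid : TCoord → TM₁) ⁻¹' O)) :=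
    isOpen_det_ne_zero.isOpenEmbedding_subtypeVal.isOpenMap _ (hO.preimage hcont)
  have hpos : 0 < volume (Subtype.val '' ((Quotient.mk tangentSetoid : TCoord → TM₁) ⁻¹' O)) := by
    refine hopen.measure_pos volume ?_
    obtain ⟨ξ, hξ⟩ := hne
    obtain ⟨q, rfl⟩ := Quotient.exists_rep ξ
    exact ⟨q.1, q, hξ, rfl⟩
  refine hpos.ne' (measure_mono_null ?_ hG)
  rintro _ ⟨q, hq, rfl⟩
  refine ⟨q.2, fun hmem => ?_⟩
  have : Quotient.mk tangentSetoid q ∈ O ∩ G := ⟨hq, hmem⟩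
  rw [hemp] at this
  exact this

/-- Along a geodesic with a good initial velocity, `𝛌` leaves every plane through the origin. -/
theorem exists_inner_lam_ne_zero {ξ : TM₁} (hξ : ξ ∈ goodVelocities) {ε : ℝ} (hε : 0 < ε)
    {x : ℝ → M₁} (hx : IsGeodesic x ε ξ) {n : E₃} (hn : n ≠ 0) :
    ∃ t ∈ Ioo (-ε) ε, inner ℝ n (lam (x t)) ≠ 0 := by
  obtain ⟨a, hsmooth, hax, ⟨hdet0, htan⟩, hgeo⟩ := hx
  obtain ⟨q, hq, hcrit⟩ := hξ
  obtain ⟨c, d, hc, h1, h2⟩ := Quotient.exact (htan.trans hq.symm)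
  by_contra! hplane
  have hnear : ∀ t ∈ Ioo (-ε) ε, Ioo (-ε) ε ∈ 𝓝 t := fun t ht => isOpen_Ioo.mem_nhds ht
  have hd : ∀ t ∈ Ioo (-ε) ε, HasMatDerivAt a (deriv a t) t := by
    intro t ht i j
    have h := (((hsmooth.differentiableOn (by simp)) t ht).differentiableAt (hnear t ht)).hasDerivAt
    exact hasDerivAt_pi.1 (hasDerivAt_pi.1 h i) j
  have hcons : ConservesMomenta a (deriv a) :=
    conservesMomenta_of_geodesic hε hd (fun t ht => (hax t ht).1) hgeo
  -- Pass to a coefficient curve with the initial data at which the criterion is known.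
  have hzero := criterion_eq_zero_of_plane (hcons.gauge (d := d) hc) hn ?_
  · refine hcrit ?_
    rw [h1, h2]
    simpa using! hzero
  · filter_upwards [hnear 0 ⟨by linarith, hε⟩] with t ht
    obtain ⟨h, hxt⟩ := hax t ht
    obtain ⟨s, -, hs⟩ := exists_trace_pauliDot_mul_gram (toGL (a t) h)
    have h3 : (pauliDot n * ((of (a t))ᴴ * of (a t))).trace.re = 0 := by
      have h4 := hplane t ht
      rw [← hxt] at h4
      exact (hs n).trans (by rw [toM₁] at h4; rw [h4, mul_zero])
    have h5 : (pauliDot n * (((c + t * d) • of (a t))ᴴ * ((c + t * d) • of (a t)))).trace.re = 0 := by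
      rw [conjTranspose_smul_mul_smul, mul_smul_comm, trace_smul, smul_eq_mul,
        Complex.re_ofReal_mul]
      exact mul_eq_zero_of_right _ h3
    exact h5

end Lump

/-- Away from a closed set of initial data of measure zero in `T M₁`, and of measure zero in each
tangent space `T_x M₁` with `𝛌(x) ≠ 0`, a geodesic of `(M₁, γ)` does not keep `𝛌(t)` in a plane
through the origin, and the lump does not stay on a great circle of `S²`, over any time interval
`(-ε, ε)`, however short. -/
theorem corollary2p2 :
    ∃ G : Set Lump.TM₁, IsOpen G ∧ Dense G ∧ Lump.NullInTM₁ Gᶜ ∧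
      (∀ (a : Lump.Coeff) (h : (Matrix.of a).det ≠ 0), Lump.lam (Lump.toM₁ a h) ≠ 0 →
        Lump.NullInFibre a h Gᶜ) ∧
      ∀ ξ ∈ G, ∀ (ε : ℝ), 0 < ε → ∀ x : ℝ → Lump.M₁, Lump.IsGeodesic x ε ξ →
        (∀ n : Lump.E₃, n ≠ 0 → ∃ t ∈ Set.Ioo (-ε) ε, inner ℝ n (Lump.lam (x t)) ≠ 0) ∧
        (∀ n : Lump.E₃, n ≠ 0 → ∃ t ∈ Set.Ioo (-ε) ε, ∀ p : Lump.E₃,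
          Lump.IsLumpPosition (x t) p → inner ℝ n p ≠ 0) := by
  refine ⟨Lump.goodVelocities, Lump.isOpen_goodVelocities,
    Lump.dense_of_nullInTM₁_compl Lump.nullInTM₁_compl_goodVelocities,
    Lump.nullInTM₁_compl_goodVelocities, Lump.nullInFibre_compl_goodVelocities,
    fun ξ hξ ε hε x hx => ⟨fun n hn => Lump.exists_inner_lam_ne_zero hξ hε hx hn, fun n hn => ?_⟩⟩
  obtain ⟨t, ht, hne⟩ := Lump.exists_inner_lam_ne_zero hξ hε hx hn
  refine ⟨t, ht, fun p hp => ?_⟩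
  have hl : Lump.lam (x t) ≠ 0 := fun h => hne (by rw [h, inner_zero_right])
  rw [Lump.eq_of_isLumpPosition hp hl, inner_neg_right, inner_smul_right]
  exact neg_ne_zero.2 (mul_ne_zero (inv_ne_zero (norm_ne_zero_iff.2 hl)) hne)
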